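/- **Setting.** Let $\mathbb M_2=\mathbb R^2$ be two-dimensional Minkowski space and let $\mathcal F$ be the space of smooth functionals $F\colon C^\infty(\mathbb M_2)\to\mathbb C$ of real configurations: $F$ is smooth along every finite-dimensional affine family of configurations, and for every $n$ and $\varphi$ the functional derivative $\frac{\delta^nF}{\delta\varphi^n}[\varphi]$ exists as a compactly supported distribution on $\mathbb M_2^n$, i.e. $\big\langle\frac{\delta^nF}{\delta\varphi^n}[\varphi],h_1\otimes\dots\otimes h_n\big\rangle=\partial_{s_1}\cdots\partial_{s_n}F[\varphi+\sum_j s_jh_j]\big|_{s=0}$. (All microcausal functionals belong to $\mathcal F$.) Products in $\mathcal F$ are pointwise, and functional derivatives in $\mathcal F[[\hbar]]$ are taken coefficientwise. Let $\Delta^F$ be the Feynman propagator or, more generally, any bidistribution on $\mathbb M_2$. For $1\le i<j\le n$ put $D^{ij}_F=\langle\Delta^F,\frac{\delta}{\delta\varphi_i}\otimes\frac{\delta}{\delta\varphi_j}\rangle$, where $\frac{\delta}{\delta\varphi_i}$ acts on the $i$-th tensor factor, and let $\mu$ denote pointwise multiplication of the factors. The (unrenormalized) time-ordered product of $F_1,\dots,F_n\in\mathcal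 F[[\hbar]]$ is $$T_n(F_1\otimes\dots\otimes F_n)=\mu\circ e^{\hbar\sum_{i<j}D^{ij}_F}(F_1\otimes\dots\otimes F_n),$$ where the exponential series is expanded into words in the $D_F^{ij}$ and everything is $\hbar$-multilinear. Each term is a pairing of a tensor product of functional derivatives of the $F_i$ with a product of propagators, one for each $D_F^{ij}$. Such a pairing is called well defined, with value $z$, if for every mollifier $\rho$ ($\rho\in C_c^\infty(\mathbb M_2)$, $\rho\ge 0$, $\int\rho=1$, $\rho_\varepsilon=\varepsilon^{-2}\rho(\cdot/\varepsilon)$) the pairings obtained by replacing $\Delta^F$ by the smooth function $\Delta^F_\varepsilon(x,y)=\langle\Delta^F,\rho_\varepsilon(x-\cdot)\otimes\rho_\varepsilon(y-\cdot)\rangle$ converge to $z$ as $\varepsilon\to0^+$. For $d_1,\dots,d_n\ge0$ with $d=d_1+\dots+d_n$ and $C\in\mathcal F[[\hbar]]$, the expression $$(\Delta^F)^{d}\,T_n\Big(\frac{\delta^{d_1}}{\delta\varphi^{d_1}}F_1\otimes\dots\otimes\frac{\delta^{d_n}}{\delta\varphi^{d_n}}F_n\Big)\frac{\delta^{d}}{\delta\varphi^{d}}C$$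 denotes the series obtained from that of $T_n(F_1\otimes\dots\otimes F_n)$ by adding to each term the further factor $C$ and $d$ further propagators, of which $d_t$ join $F_t$ to $C$, for each $t$; all arguments are paired simultaneously. **Proposition.** Let $l,c\ge0$, let $A_1,\dots,A_l,B,C\in\mathcal F[[\hbar]]$, and suppose that $\frac{\delta^i}{\delta\varphi^i}C=0$ for all $i>c$ (no such restriction is made on the $A_t$ and $B$). Suppose that all the pairings occurring in the terms on the right-hand side below, taken for all coefficients of the series $A_t,B,C$ and at all configurations, are well defined. Then all those occurring in $T_{l+1}(A_1\otimes\dots\otimes A_l\otimes(B\,C))$ are well defined, and $$T_{l+1}\big(A_1\otimes\dots\otimes A_l\otimes(B\,C)\big)=\sum_{i=0}^{c}\hbar^i(\Delta^F)^i\sum_{\substack{i_1,\dots,i_l\ge0\\ i_1+\dots+i_l=i}}\frac{1}{i_1!\cdots i_l!}\,T_{l+1}\Big(\frac{\delta^{i_1}}{\delta\varphi^{i_1}}A_1\otimes\dots\otimes\frac{\delta^{i_l}}{\delta\varphi^{i_l}}A_l\otimes B\Big)\frac{\delta^i}{\delta\varphi^i}C .$$ In particular, for $A_1=\dots=A_l=A$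 this is the formula for $T_{l+1}\big(A^{\otimes l}\otimes(B\,C)\big)$. -/

import Mathlib

open scoped ContDiff Topology Distributions

noncomputable section

namespace PAQFT

/-! ### Configurations, functionals, compactly supported distributions -/

/-- Two-dimensional Minkowski space `𝕄₂`, as the affine manifold `ℝ²`. (The metric enters the
constructions below only through the propagator.) -/
abbrev Spacetime : Type := EuclideanSpace ℝ (Fin 2)

/-- The space `C^∞(𝕄₂)` of (real) field configurations. -/
def Config : Submodule ℝ (Spacetime → ℝ) where
  carrier := {f | ContDiff ℝ ∞ f}
  add_mem' hf hg := by
    rw [Set.mem_ofPred_eq] at *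
    exact hf.add hg
  zero_mem' := by
    rw [Set.mem_ofPred_eq]
    exact contDiff_const
  smul_mem' c _ hf := by
    rw [Set.mem_ofPred_eq] at *
    exact hf.const_smul c

/-- A functional `F : C^∞(𝕄₂) → ℂ`. Sums and products of functionals are pointwise. -/
abbrev Functional : Type := Config → ℂ

/-- `C^∞(𝕄₂^L, ℂ)`: smooth functions of one spacetime point for each `j ∈ L`. -/
def SmoothFun (L : Type) [Fintype L] : Submodule ℂ ((L → Spacetime) → ℂ) where
  carrier := {f | ContDiff ℝ ∞ f}
  add_mem' hf hg := by
    rw [Set.mem_ofPred_eq] at *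
    exact hf.add hg
  zero_mem' := by
    rw [Set.mem_ofPred_eq]
    exact contDiff_const
  smul_mem' c _ hf := by
    rw [Set.mem_ofPred_eq] at *
    exact hf.const_smul c

/-- The space `𝓔'(𝕄₂^L)` of compactly supported distributions: linear forms on `C^∞(𝕄₂^L, ℂ)`
bounded by the size of finitely many derivatives on a compact set. -/
def CompactDistribution (L : Type) [Fintype L] : Submodule ℂ (SmoothFun L →ₗ[ℂ] ℂ) where
  carrier := {u | ∃ (K : Set (L → Spacetime)) (m : ℕ) (M : ℝ), IsCompact K ∧
    ∀ (f : SmoothFun L) (b : ℝ),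
      (∀ i ≤ m, ∀ x ∈ K, ‖iteratedFDeriv ℝ i (f : (L → Spacetime) → ℂ) x‖ ≤ b) →
        ‖u f‖ ≤ M * b}
  add_mem' := by
    rintro u v ⟨K, m, M, hK, hu⟩ ⟨K', m', M', hK', hv⟩
    refine ⟨K ∪ K', max m m', M + M', hK.union hK', fun f b hb => ?_⟩
    have h1 := hu f b fun i hi x hx => hb i (hi.trans (le_max_left _ _)) x (Or.inl hx)
    have h2 := hv f b fun i hi x hx => hb i (hi.trans (le_max_right _ _)) x (Or.inr hx)
    calc ‖(u + v) f‖ ≤ ‖u f‖ + ‖v f‖ := norm_add_le _ _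
      _ ≤ (M + M') * b := by linarith
  zero_mem' := ⟨∅, 0, 0, isCompact_empty, fun f b _ => by simp⟩
  smul_mem' := by
    rintro c u ⟨K, m, M, hK, hu⟩
    refine ⟨K, m, ‖c‖ * M, hK, fun f b hb => ?_⟩
    have h1 := mul_le_mul_of_nonneg_left (hu f b hb) (norm_nonneg c)
    simpa [mul_assoc] using h1

/-- The value of a compactly supported distribution on a smooth function. (It is only ever used
for smooth functions; on other functions it is set to `0`.) -/
def evalDist {L : Type} [Fintype L] (u : CompactDistribution L)
    (f : (L → Spacetime) → ℂ) : ℂ :=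
  open Classical in
  if hf : ContDiff ℝ ∞ f then (u : SmoothFun L →ₗ[ℂ] ℂ) ⟨f, hf⟩ else 0

/-- The function `⨂ h_j : x ↦ ∏ h_j(x_j)`. -/
def tensorFun {L : Type} [Fintype L] (h : L → Config) (x : L → Spacetime) : ℂ :=
  ∏ j, (((h j : Spacetime → ℝ) (x j) : ℝ) : ℂ)

/-! ### Functional derivatives -/

/-- The iterated directional derivative
`∂^{|L|} / ∏_j ∂s_j  F[φ + ∑_j s_j h_j]` at `s = 0`. -/
def dirDeriv (F : Functional) (φ : Config) {L : Type} [Fintype L] (h : L → Config) : ℂ :=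
  open Classical in
  iteratedFDeriv ℝ (Fintype.card L) (fun s : L → ℝ => F (φ + ∑ j, s j • h j)) 0
    (fun a => Pi.single ((Fintype.equivFin L).symm a) (1 : ℝ))

/-- The distribution `u ∈ 𝓔'(𝕄₂^n)` is the `n`-th functional derivative `δⁿF/δφⁿ` at `φ`. -/
def IsFunctionalDeriv (F : Functional) (φ : Config) {n : ℕ}
    (u : CompactDistribution (Fin n)) : Prop :=
  ∀ h : Fin n → Config, evalDist u (tensorFun h) = dirDeriv F φ h

/-- Smooth functionals: smooth along every finite-dimensional family of configurations, with
functional derivatives of every order that are compactly supported distributions. Microcausal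
functionals are smooth functionals with a further restriction on the wave front sets of their
derivatives, which plays no role here. -/
def IsSmooth (F : Functional) : Prop :=
  (∀ (φ : Config) (n : ℕ) (h : Fin n → Config),
    ContDiff ℝ ∞ (fun s : Fin n → ℝ => F (φ + ∑ j, s j • h j))) ∧
  ∀ (φ : Config) (n : ℕ), ∃ u : CompactDistribution (Fin n), IsFunctionalDeriv F φ u

/-- Given functionals `F_i` (`i < n`) and legs `j ∈ L`, the leg `j` being attached to the functional
`F_{v j}`: the distribution `w` on `𝕄₂^L` is the tensor product `⨂_i δ^{n_i}F_i/δφ^{n_i}` at `φ`,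
where `n_i` is the number of legs attached to `F_i` and each derivative acts on its own legs;
equivalently it is `∏_j δ/δφ_{v j}(x_j)` applied to `F_0 ⊗ ⋯ ⊗ F_{n-1}`, at `(φ, …, φ)`. -/
def IsTensorDeriv {n : ℕ} (F : Fin n → Functional) {L : Type} [Fintype L] (v : L → Fin n)
    (φ : Config) (w : CompactDistribution L) : Prop :=
  ∀ h : L → Config, evalDist w (tensorFun h) =
    ∏ i, dirDeriv (F i) φ (fun j : {j : L // v j = i} => h j)

/-! ### Regularised propagators -/

/-- Nonnegative smooth compactly supported functions with integral one. -/
structure IsMollifier (ρ : Spacetime → ℝ) : Prop where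
  smooth : ContDiff ℝ ∞ ρ
  compact : HasCompactSupport ρ
  nonneg : ∀ x, 0 ≤ ρ x
  integral_eq_one : ∫ x, ρ x = 1

/-- `ρ_ε(x) = ε⁻² ρ(x / ε)`. -/
def scaled (ρ : Spacetime → ℝ) (ε : ℝ) (x : Spacetime) : ℝ := (ε⁻¹) ^ 2 * ρ (ε⁻¹ • x)

theorem scaled_contDiff {ρ : Spacetime → ℝ} (hρ : IsMollifier ρ) (ε : ℝ) :
    ContDiff ℝ ∞ (scaled ρ ε) :=
  contDiff_const.mul (hρ.smooth.comp (contDiff_const_smul _))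

theorem scaled_compact {ρ : Spacetime → ℝ} (hρ : IsMollifier ρ) (ε : ℝ) :
    HasCompactSupport (scaled ρ ε) := by
  rcases eq_or_ne ε 0 with rfl | hε
  · have : scaled ρ 0 = 0 := by ext x; simp [scaled]
    rw [this]; exact HasCompactSupport.zero
  · exact (hρ.compact.comp_smul (inv_ne_zero hε)).mul_left

/-- The test function `(x', y') ↦ ρ_ε(x - x') ρ_ε(y - y')` on `𝕄₂ × 𝕄₂`. -/
def mollifierAt {ρ : Spacetime → ℝ} (hρ : IsMollifier ρ) (ε : ℝ) (x y : Spacetime) :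
    𝓓((⊤ : TopologicalSpace.Opens (Spacetime × Spacetime)), ℝ) where
  toFun z := scaled ρ ε (x - z.1) * scaled ρ ε (y - z.2)
  contDiff' := by
    have h := scaled_contDiff hρ ε
    exact (h.comp (contDiff_const.sub contDiff_fst)).mul
      (h.comp (contDiff_const.sub contDiff_snd))
  hasCompactSupport' := by
    have h := scaled_compact hρ ε
    have hx := h.comp_homeomorph (Homeomorph.subLeft x)
    have hy := h.comp_homeomorph (Homeomorph.subLeft y)
    refine HasCompactSupport.intro (hx.isCompact.prod hy.isCompact) fun z hz => ?_
    rw [Set.mem_prod, not_and_or] at hz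
    rcases hz with hz | hz
    · have := image_eq_zero_of_notMem_tsupport hz
      simp only [Function.comp_apply, Homeomorph.coe_subLeft] at this
      simp [this]
    · have := image_eq_zero_of_notMem_tsupport hz
      simp only [Function.comp_apply, Homeomorph.coe_subLeft] at this
      simp [this]
  tsupport_subset' := fun _ _ => trivial

/-- A bidistribution on `𝕄₂`. -/
abbrev Bidistribution : Type :=
  𝓓'((⊤ : TopologicalSpace.Opens (Spacetime × Spacetime)), ℂ)

/-- The regularised propagator `Δ_ε(x, y) = ⟨Δ, ρ_ε(x - ·) ⊗ ρ_ε(y - ·)⟩`, a smooth function. -/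
def regProp (Δ : Bidistribution) {ρ : Spacetime → ℝ} (hρ : IsMollifier ρ) (ε : ℝ)
    (x y : Spacetime) : ℂ :=
  Δ (mollifierAt hρ ε x y)

/-! ### Contractions and time-ordered products -/

/-- Let `κ` be a finite set of edges, the edge `a` going from the factor `src a` to the factor
`tgt a`. The (unrenormalized) contraction
`μ ∘ ∏_a ⟨Δ, δ/δφ_{src a} ⊗ δ/δφ_{tgt a}⟩ (F_0 ⊗ ⋯ ⊗ F_{n-1})`
is well defined at `φ`, with value `z`: the distribution `⨂_i δ^{n_i}F_i/δφ^{n_i}` can be paired with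
`∏_a Δ(x_a, y_a)`, the pairing being the limit of the pairings with the regularised propagators,
independently of the regularisation. -/
def HasContraction (Δ : Bidistribution) {n : ℕ} (F : Fin n → Functional) {κ : Type} [Fintype κ]
    (src tgt : κ → Fin n) (φ : Config) (z : ℂ) : Prop :=
  ∃ w : CompactDistribution (κ ⊕ κ), IsTensorDeriv F (Sum.elim src tgt) φ w ∧
    ∀ (ρ : Spacetime → ℝ) (hρ : IsMollifier ρ),
      Filter.Tendsto
        (fun ε : ℝ => evalDist w fun x => ∏ a, regProp Δ hρ ε (x (Sum.inl a)) (x (Sum.inr a)))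
        (𝓝[>] 0) (𝓝 z)

/-- The value of the contraction (and `0` where it is not well defined). -/
def contraction (Δ : Bidistribution) {n : ℕ} (F : Fin n → Functional) {κ : Type} [Fintype κ]
    (src tgt : κ → Fin n) : Functional := fun φ =>
  open Classical in
  if h : ∃ z, HasContraction Δ F src tgt φ z then h.choose else 0

/-- Contractions of formal power series in `ħ` are well defined if those of all coefficients are. -/
def ContractionDefined (Δ : Bidistribution) {n : ℕ} (F : Fin n → PowerSeries Functional)
    {κ : Type} [Fintype κ] (src tgt : κ → Fin n) : Prop :=
  ∀ (k : Fin n → ℕ) (φ : Config),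
    ∃ z, HasContraction Δ (fun i => PowerSeries.coeff (k i) (F i)) src tgt φ z

/-- Contraction of formal power series in `ħ`, by `ħ`-multilinearity. -/
def contractionSeries (Δ : Bidistribution) {n : ℕ} (F : Fin n → PowerSeries Functional)
    {κ : Type} [Fintype κ] (src tgt : κ → Fin n) : PowerSeries Functional :=
  PowerSeries.mk fun N => ∑ k ∈ Finset.piAntidiag Finset.univ N,
    contraction Δ (fun i => PowerSeries.coeff (k i) (F i)) src tgt

/-- Pairs `i < j` of factors. -/
abbrev Pairs (n : ℕ) : Type := {p : Fin n × Fin n // p.1 < p.2}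

/-- Sum of a power series `∑_j ħ^j a_j` whose terms `a_j` are themselves power series in `ħ`. -/
def hbarSum (a : ℕ → PowerSeries Functional) : PowerSeries Functional :=
  PowerSeries.mk fun N =>
    PowerSeries.coeff N (∑ j ∈ Finset.range (N + 1), PowerSeries.X ^ j * a j)

/-- The time-ordered product
`T_n(F_0 ⊗ ⋯ ⊗ F_{n-1}) = μ ∘ exp(ħ ∑_{i<j} D^{ij}) (F_0 ⊗ ⋯ ⊗ F_{n-1})`, with
`D^{ij} = ⟨Δ, δ/δφ_i ⊗ δ/δφ_j⟩`; the power `(∑_{i<j} D^{ij})^m` is expanded as the sum over all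
words `e` of length `m` in the pairs. -/
def timeOrdered (Δ : Bidistribution) {n : ℕ} (F : Fin n → PowerSeries Functional) :
    PowerSeries Functional :=
  hbarSum fun m => (m.factorial : ℂ)⁻¹ • ∑ e : Fin m → Pairs n,
    contractionSeries Δ F (fun a => (e a).1.1) (fun a => (e a).1.2)

/-- All terms of `T_n(F_0 ⊗ ⋯ ⊗ F_{n-1})` are well defined. -/
def TimeOrderedDefined (Δ : Bidistribution) {n : ℕ} (F : Fin n → PowerSeries Functional) : Prop :=
  ∀ (m : ℕ) (e : Fin m → Pairs n),
    ContractionDefined Δ F (fun a => (e a).1.1) (fun a => (e a).1.2)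

/-- The edges of a term of `(Δ)^{|d|} T_n(δ^{d_0}F_0 ⊗ ⋯ ⊗ δ^{d_{n-1}}F_{n-1}) δ^{|d|}C`: those of a
term of `T_n`, and `d_t` edges from `F_t` to the additional last factor `C` for every `t`. -/
abbrev LegEdges {n : ℕ} (m : ℕ) (d : Fin n → ℕ) : Type := Fin m ⊕ (Σ t : Fin n, Fin (d t))

/-- First end points of the edges. -/
def legSrc {n m : ℕ} (d : Fin n → ℕ) (e : Fin m → Pairs n) : LegEdges m d → Fin (n + 1) :=
  Sum.elim (fun a => (e a).1.1.castSucc) (fun s => s.1.castSucc)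

/-- Second end points of the edges. -/
def legTgt {n m : ℕ} (d : Fin n → ℕ) (e : Fin m → Pairs n) : LegEdges m d → Fin (n + 1) :=
  Sum.elim (fun a => (e a).1.2.castSucc) (fun _ => Fin.last n)

/-- The pairing `(Δ)^{|d|} T_n(δ^{d_0}F_0 ⊗ ⋯ ⊗ δ^{d_{n-1}}F_{n-1}) δ^{|d|}C`, where
`T_n(δ^{d_0}F_0 ⊗ ⋯)` is the time-ordered product of distribution-valued functionals, with
`|d| = ∑ d_t` arguments left open, and the `|d|` propagators join each of these open arguments to
one of the arguments of `δ^{|d|}C`. -/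
def timeOrderedPaired (Δ : Bidistribution) {n : ℕ} (F : Fin n → PowerSeries Functional)
    (d : Fin n → ℕ) (C : PowerSeries Functional) : PowerSeries Functional :=
  hbarSum fun m => (m.factorial : ℂ)⁻¹ • ∑ e : Fin m → Pairs n,
    contractionSeries Δ (Fin.snoc (α := fun _ => PowerSeries Functional) F C)
      (legSrc d e) (legTgt d e)

/-- All terms of `(Δ)^{|d|} T_n(δ^{d_0}F_0 ⊗ ⋯ ⊗ δ^{d_{n-1}}F_{n-1}) δ^{|d|}C` are well defined. -/
def TimeOrderedPairedDefined (Δ : Bidistribution) {n : ℕ} (F : Fin n → PowerSeries Functional)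
    (d : Fin n → ℕ) (C : PowerSeries Functional) : Prop :=
  ∀ (m : ℕ) (e : Fin m → Pairs n),
    ContractionDefined Δ (Fin.snoc (α := fun _ => PowerSeries Functional) F C)
      (legSrc d e) (legTgt d e)

end PAQFT

end

/-!
For functionals that are smooth along finite-dimensional affine families, the directional
derivatives form a commuting family of derivations, so the Leibniz rule distributes the legs
attached to `B C` over `B` and `C` in all possible ways. Each leg belongs to its own edge, hence a
contraction of `A_1 ⊗ ⋯ ⊗ A_l ⊗ B C` is the sum of the contractions of `A_1 ⊗ ⋯ ⊗ A_l ⊗ B ⊗ C` over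
all ways of moving the end points of edges from `B C` to either `B` or `C`. No edge joins `B` to
`C`, since both of its ends would have been attached to `B C`.

The value of a contraction depends only on the multigraph formed by its edges, and it does not
depend on the distribution representing the tensor product of functional derivatives: a compactly
supported distribution is continuous in the jets over a compact set, and convolution with products
of bump functions approximates every smooth function in these seminorms by linear combinations of
products `⨂ h_j`. Words of length `m` in two kinds of edges, those of `T_{l+1}` and the `l` edges
from `A_t` to `C`, are therefore counted by the binomial and multinomial theorems, which turn
`1 / m!` into `1 / (m - i)!` times `∏_t 1 / i_t!`. The terms with more than `c` edges ending at `C`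
vanish.
-/

noncomputable section

local notation:67 x:67 "▹" y:68 => Fin.snoc (α := fun _ => _) x y

namespace PAQFT

open MeasureTheory ContinuousLinearMap

/-! ### Density of tensor products of test functions -/

section Convolution

variable {V F R : Type*} [NormedAddCommGroup V] [NormedSpace ℝ V]
  [MeasurableSpace V] [BorelSpace V] {μ : Measure V}
  [NormedAddCommGroup F] [NormedSpace ℝ F]

theorem iteratedFDeriv_convolution_lsmul [SFinite μ] [μ.IsAddLeftInvariant]
    [NormedField R] [NormedAlgebra ℝ R] [NormedSpace R F] [IsScalarTower ℝ R F]
    {f : V → R} {k : V → F} (hf : LocallyIntegrable f μ) (hk : ContDiff ℝ ∞ k)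
    (hkc : HasCompactSupport k) (i : ℕ) :
    iteratedFDeriv ℝ i (convolution f k (lsmul ℝ R) μ) =
      convolution f (iteratedFDeriv ℝ i k) (lsmul ℝ R) μ := by
  induction i with
  | zero =>
    ext1 x
    simp only [iteratedFDeriv_zero_eq_comp, Function.comp_apply, convolution]
    rw [← LinearIsometryEquiv.coe_toContinuousLinearEquiv,
      ← ContinuousLinearEquiv.integral_comp_comm]
    rfl
  | succ i ih =>
    have hki : ContDiff ℝ 1 (iteratedFDeriv ℝ i k) :=
      hk.iteratedFDeriv_right (by exact_mod_cast le_top)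
    ext1 x
    rw [iteratedFDeriv_succ_eq_comp_left, ih, iteratedFDeriv_succ_eq_comp_left,
      Function.comp_apply,
      ((hkc.iteratedFDeriv i).hasFDerivAt_convolution_right (lsmul ℝ R) hf hki x).fderiv]
    exact (ContinuousLinearEquiv.integral_comp_comm (μ := μ) (𝕜 := ℝ)
      (E := V →L[ℝ] V [×i]→L[ℝ] F)
      (F := V [×(i + 1)]→L[ℝ] F) (continuousMultilinearCurryLeftEquiv ℝ
        (fun _ : Fin (i + 1) => V) F).symm.toContinuousLinearEquiv _).symm

theorem eventually_dist_iteratedFDeriv_convolution_le [SFinite μ] [μ.IsAddLeftInvariant]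
    [CompleteSpace F] [SecondCountableTopology V]
    {g : V → F} (hg : ContDiff ℝ ∞ g) (hgc : HasCompactSupport g)
    (i : ℕ) {δ : ℝ} (hδ : 0 < δ) :
    ∀ᶠ r in 𝓝[>] (0 : ℝ), ∀ k : V → ℝ, LocallyIntegrable k μ →
      Function.support k ⊆ Metric.ball 0 r → (∀ x, 0 ≤ k x) → ∫ x, k x ∂μ = 1 →
        ∀ x, dist (iteratedFDeriv ℝ i (convolution k g (lsmul ℝ ℝ) μ) x)
          (iteratedFDeriv ℝ i g x) ≤ δ := by
  have hcont : Continuous (iteratedFDeriv ℝ i g) :=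
    hg.continuous_iteratedFDeriv (by exact_mod_cast le_top)
  obtain ⟨r₀, hr₀, hr₀δ⟩ := Metric.uniformContinuous_iff.1
    ((hgc.iteratedFDeriv i).uniformContinuous_of_continuous hcont) δ hδ
  filter_upwards [Ioo_mem_nhdsGT hr₀] with r hr k hk hkr hk0 hk1 x
  rw [iteratedFDeriv_convolution_lsmul hk hg hgc]
  exact dist_convolution_le hδ.le hkr hk0 hk1 hcont.aestronglyMeasurable
    fun y hy => (hr₀δ (hy.trans hr.2)).le

end Convolution

theorem integral_mem_of_isClosed {X E : Type*} [MeasurableSpace X] {μ : Measure X}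
    [NormedAddCommGroup E] [NormedSpace ℝ E] [CompleteSpace E] {S : Submodule ℝ E}
    (hS : IsClosed (S : Set E)) {f : X → E} (hf : Integrable f μ) (h : ∀ x, f x ∈ S) :
    ∫ x, f x ∂μ ∈ S := by
  have : IsClosed (S : Set E) := hS
  have hint := S.mkQL.integral_comp_comm hf
  have hzero : ∀ x, S.mkQL (f x) = 0 := fun x => (Submodule.Quotient.mk_eq_zero S).2 (h x)
  simp only [hzero, integral_zero] at hint
  exact (Submodule.Quotient.mk_eq_zero S).1 hint.symm

section Jets

variable {L : Type} [Fintype L]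

theorem contDiff_smoothFun (f : SmoothFun L) : ContDiff ℝ ∞ (f : (L → Spacetime) → ℂ) := f.2

theorem contDiff_tensorFun (h : L → Config) : ContDiff ℝ ∞ (tensorFun h) :=
  contDiff_prod fun j _ => Complex.ofRealCLM.contDiff.comp
    ((show ContDiff ℝ ∞ (h j : Spacetime → ℝ) from (h j).2).comp (contDiff_apply ℝ Spacetime j))

/-- `ℝ`-multilinear forms on `𝕄₂^L`, as a type synonym on which instance search only finds the
norm. -/
def MultiForm (L : Type) (i : ℕ) : Type := (L → Spacetime) [×i]→L[ℝ] ℂ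

instance (i : ℕ) : NormedAddCommGroup (MultiForm L i) :=
  inferInstanceAs (NormedAddCommGroup ((L → Spacetime) [×i]→L[ℝ] ℂ))

instance (i : ℕ) : NormedSpace ℝ (MultiForm L i) :=
  inferInstanceAs (NormedSpace ℝ ((L → Spacetime) [×i]→L[ℝ] ℂ))

instance (i : ℕ) : CompleteSpace (MultiForm L i) :=
  inferInstanceAs (CompleteSpace ((L → Spacetime) [×i]→L[ℝ] ℂ))

/-- The Banach space in which the derivatives up to order `m` of a smooth function on `𝕄₂^L`,
restricted to the compact set `K`, take their values. -/
abbrev JetSpace (K : TopologicalSpace.Compacts (L → Spacetime)) (m : ℕ) : Type :=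
  C(K, ∀ i : Fin (m + 1), MultiForm L i)

variable {K : TopologicalSpace.Compacts (L → Spacetime)} {m : ℕ}

/-- The jet of order `m` of a smooth function along the compact set `K`. -/
def jet (K : TopologicalSpace.Compacts (L → Spacetime)) (m : ℕ) :
    SmoothFun L →ₗ[ℝ] JetSpace K m where
  toFun f :=
    { toFun := fun x i => iteratedFDeriv ℝ i (f : (L → Spacetime) → ℂ) x
      continuous_toFun := continuous_pi fun i =>
        ((contDiff_smoothFun f).continuous_iteratedFDeriv (by exact_mod_cast le_top)).comp
          continuous_subtype_val }
  map_add' f g := by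
    ext1 x
    exact funext fun i => iteratedFDeriv_add_apply
      ((contDiff_smoothFun f).contDiffAt.of_le (by exact_mod_cast le_top))
      ((contDiff_smoothFun g).contDiffAt.of_le (by exact_mod_cast le_top))
  map_smul' c f := by
    ext1 x
    exact funext fun i => iteratedFDeriv_const_smul_apply
      ((contDiff_smoothFun f).contDiffAt.of_le (by exact_mod_cast le_top))

theorem jet_apply (f : SmoothFun L) (x : K) (i : Fin (m + 1)) :
    jet K m f x i = iteratedFDeriv ℝ i (f : (L → Spacetime) → ℂ) x := rfl

theorem norm_jet_apply_le (f : SmoothFun L) (x : K) (i : Fin (m + 1)) :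
    ‖iteratedFDeriv ℝ i (f : (L → Spacetime) → ℂ) x‖ ≤ ‖jet K m f‖ :=
  (norm_le_pi_norm (jet K m f x) i).trans ((jet K m f).norm_coe_le_norm x)

theorem JetSpace.norm_le {f : JetSpace K m} {δ : ℝ} (hδ : 0 ≤ δ) (h : ∀ x i, ‖f x i‖ ≤ δ) :
    ‖f‖ ≤ δ :=
  (ContinuousMap.norm_le _ hδ).2 fun x => (pi_norm_le_iff_of_nonneg hδ).2 (h x)

/-- The translate `x ↦ k (x - y)`. -/
def translate (k : SmoothFun L) (y : L → Spacetime) : SmoothFun L :=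
  ⟨fun x => (k : (L → Spacetime) → ℂ) (x - y),
    (contDiff_smoothFun k).comp (contDiff_id.sub contDiff_const)⟩

theorem jet_smul_translate_apply (c : ℂ) (k : SmoothFun L) (y : L → Spacetime) (x : K)
    (i : Fin (m + 1)) :
    jet K m (c • translate k y) x i =
      c • iteratedFDeriv ℝ i (k : (L → Spacetime) → ℂ) ((x : L → Spacetime) - y) := by
  rw [← iteratedFDeriv_comp_sub]
  exact iteratedFDeriv_const_smul_apply
    ((contDiff_smoothFun (translate k y)).contDiffAt.of_le (by exact_mod_cast le_top))

theorem integrable_jet_smul_translate {g : SmoothFun L}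
    (hg : HasCompactSupport (g : (L → Spacetime) → ℂ)) (k : SmoothFun L) :
    Integrable fun y => jet K m ((g : (L → Spacetime) → ℂ) y • translate k y) := by
  refine Continuous.integrable_of_hasCompactSupport ?_ (hg.mono fun y hy => ?_)
  · refine ContinuousMap.continuous_of_continuous_uncurry _ (continuous_pi fun i => ?_)
    simp only [Function.uncurry_def, jet_smul_translate_apply]
    exact ((contDiff_smoothFun g).continuous.comp continuous_fst).smul
      (((contDiff_smoothFun k).continuous_iteratedFDeriv (by exact_mod_cast le_top)).comp
        ((continuous_subtype_val.comp continuous_snd).sub continuous_fst))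
  · contrapose! hy
    rw [Function.notMem_support] at hy ⊢
    rw [hy, zero_smul, map_zero]

/-- The convolution of two smooth functions, the second one compactly supported. -/
def smoothConv (k g : SmoothFun L) (hg : HasCompactSupport (g : (L → Spacetime) → ℂ)) :
    SmoothFun L :=
  ⟨convolution (k : (L → Spacetime) → ℂ) (g : (L → Spacetime) → ℂ) (lsmul ℝ ℂ) volume,
    hg.contDiff_convolution_right _ (contDiff_smoothFun k).continuous.locallyIntegrable
      (contDiff_smoothFun g)⟩

theorem jet_smoothConv {k g : SmoothFun L} (hk : HasCompactSupport (k : (L → Spacetime) → ℂ))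
    (hg : HasCompactSupport (g : (L → Spacetime) → ℂ)) :
    jet K m (smoothConv k g hg) =
      ∫ y, jet K m ((g : (L → Spacetime) → ℂ) y • translate k y) := by
  have hint := integrable_jet_smul_translate (K := K) (m := m) hg k
  have hinv : (volume : Measure (L → Spacetime)).IsNegInvariant := Measure.pi.isNegInvariant _
  have hcomm : (smoothConv k g hg : (L → Spacetime) → ℂ) =
      convolution (g : (L → Spacetime) → ℂ) (k : (L → Spacetime) → ℂ) (lsmul ℝ ℂ) volume := by
    rw [← convolution_flip]
    change convolution _ _ _ _ = _
    congr 1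
    ext
    simp [mul_comm]
  ext1 x
  have hintx : ∀ i, Integrable fun y =>
      jet K m ((g : (L → Spacetime) → ℂ) y • translate k y) x i :=
    integrable_pi_iff.1 ((ContinuousMap.evalCLM ℝ x).integrable_comp hint)
  refine funext fun i => ?_
  rw [ContinuousMap.integral_apply hint, eval_integral hintx, jet_apply, hcomm,
    iteratedFDeriv_convolution_lsmul
      (contDiff_smoothFun g).continuous.locallyIntegrable (contDiff_smoothFun k) hk]
  simp only [jet_smul_translate_apply]
  rfl

/-- The product of `|L|` copies of a normalised bump function of one spacetime point. -/
def tensorBump (L : Type) [Fintype L] (b : ContDiffBump (0 : Spacetime)) (x : L → Spacetime) : ℝ :=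
  ∏ j, b.normed volume (x j)

theorem contDiff_tensorBump (b : ContDiffBump (0 : Spacetime)) : ContDiff ℝ ∞ (tensorBump L b) :=
  contDiff_prod fun j _ => b.contDiff_normed.comp (contDiff_apply ℝ Spacetime j)

theorem tensorBump_nonneg (b : ContDiffBump (0 : Spacetime)) (x : L → Spacetime) :
    0 ≤ tensorBump L b x :=
  Finset.prod_nonneg fun _ _ => b.nonneg_normed _

theorem integral_tensorBump (b : ContDiffBump (0 : Spacetime)) :
    ∫ x, tensorBump L b x = 1 := by
  simp only [tensorBump]
  rw [volume_pi, integral_fintype_prod_eq_prod (𝕜 := ℝ) (fun _ => b.normed volume)]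
  simp [b.integral_normed]

theorem support_tensorBump (b : ContDiffBump (0 : Spacetime)) :
    Function.support (tensorBump L b) ⊆ Metric.ball 0 b.rOut := by
  intro x hx
  rw [Function.mem_support, tensorBump, Finset.prod_ne_zero_iff] at hx
  rw [mem_ball_zero_iff, pi_norm_lt_iff b.rOut_pos]
  intro j
  have hj : x j ∈ Function.support (b.normed volume) := hx j (Finset.mem_univ j)
  rwa [b.support_normed_eq, mem_ball_zero_iff] at hj

theorem hasCompactSupport_tensorBump (b : ContDiffBump (0 : Spacetime)) :
    HasCompactSupport (tensorBump L b) :=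
  HasCompactSupport.of_support_subset_isCompact (isCompact_closedBall 0 b.rOut)
    ((support_tensorBump b).trans Metric.ball_subset_closedBall)

/-- A product of bump functions as a complex-valued smooth function. -/
def smoothTensorBump (L : Type) [Fintype L] (b : ContDiffBump (0 : Spacetime)) : SmoothFun L :=
  ⟨fun x => (tensorBump L b x : ℂ), Complex.ofRealCLM.contDiff.comp (contDiff_tensorBump b)⟩

variable (L) in
/-- The linear span of the functions `⨂ h_j`. -/
def tensorSpan : Submodule ℂ (SmoothFun L) :=
  Submodule.span ℂ (Set.range fun h : L → Config => ⟨tensorFun h, contDiff_tensorFun h⟩)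

theorem translate_smoothTensorBump_mem_tensorSpan (b : ContDiffBump (0 : Spacetime))
    (y : L → Spacetime) : translate (smoothTensorBump L b) y ∈ tensorSpan L := by
  let h : L → Config := fun j =>
    ⟨fun x => b.normed volume (x - y j), b.contDiff_normed.comp (contDiff_id.sub contDiff_const)⟩
  refine Submodule.subset_span ⟨h, Subtype.ext (funext fun x => ?_)⟩
  simp [tensorFun, smoothTensorBump, translate, tensorBump, h]

variable (K m) in
/-- The closure of the jets of linear combinations of functions `⨂ h_j`. -/
def tensorJets : Submodule ℝ (JetSpace K m) :=
  (((tensorSpan L).restrictScalars ℝ).map (jet K m)).topologicalClosure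

theorem jet_smoothConv_mem_tensorJets (b : ContDiffBump (0 : Spacetime)) {g : SmoothFun L}
    (hg : HasCompactSupport (g : (L → Spacetime) → ℂ)) :
    jet K m (smoothConv (smoothTensorBump L b) g hg) ∈ tensorJets K m := by
  have hk : HasCompactSupport (smoothTensorBump L b : (L → Spacetime) → ℂ) :=
    (hasCompactSupport_tensorBump b).comp_left (g := ((↑) : ℝ → ℂ)) Complex.ofReal_zero
  rw [jet_smoothConv hk hg]
  refine integral_mem_of_isClosed (Submodule.isClosed_topologicalClosure _)
    (integrable_jet_smul_translate hg _) fun y => Submodule.le_topologicalClosure _ ?_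
  exact Submodule.mem_map_of_mem
    (Submodule.smul_mem _ _ (translate_smoothTensorBump_mem_tensorSpan b y))

theorem exists_norm_jet_smoothConv_sub_le (K : TopologicalSpace.Compacts (L → Spacetime)) (m : ℕ)
    {g : SmoothFun L} (hg : HasCompactSupport (g : (L → Spacetime) → ℂ)) {δ : ℝ} (hδ : 0 < δ) :
    ∃ b : ContDiffBump (0 : Spacetime),
      ‖jet K m (smoothConv (smoothTensorBump L b) g hg) - jet K m g‖ ≤ δ := by
  have hev := Filter.eventually_all.2 fun i : Fin (m + 1) =>
    eventually_dist_iteratedFDeriv_convolution_le (μ := (volume : Measure (L → Spacetime)))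
      (contDiff_smoothFun g) hg i hδ
  obtain ⟨r, hclose, hr⟩ := (hev.and self_mem_nhdsWithin).exists
  have hr : 0 < r := hr
  let b : ContDiffBump (0 : Spacetime) := ⟨r / 2, r, half_pos hr, half_lt_self hr⟩
  have hconv : (smoothConv (smoothTensorBump L b) g hg : (L → Spacetime) → ℂ) =
      convolution (tensorBump L b) (g : (L → Spacetime) → ℂ) (lsmul ℝ ℝ) volume := by
    ext x
    simp [smoothConv, smoothTensorBump, convolution]
  refine ⟨b, JetSpace.norm_le hδ.le fun x i => ?_⟩
  rw [ContinuousMap.sub_apply, Pi.sub_apply, ← dist_eq_norm, jet_apply, hconv]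
  exact hclose i _ (contDiff_tensorBump b).continuous.locallyIntegrable (support_tensorBump b)
    (tensorBump_nonneg b) (integral_tensorBump b) x

theorem exists_hasCompactSupport_jet_eq (K : TopologicalSpace.Compacts (L → Spacetime)) (m : ℕ)
    (f : SmoothFun L) :
    ∃ g : SmoothFun L, HasCompactSupport (g : (L → Spacetime) → ℂ) ∧ jet K m g = jet K m f := by
  obtain ⟨R, hR, hKR⟩ := K.isCompact.isBounded.subset_ball_lt 0 (0 : L → Spacetime)
  let χ : ContDiffBump (0 : L → Spacetime) := ⟨R, R + 1, hR, by linarith⟩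
  let g : SmoothFun L := ⟨fun x => (χ x : ℂ) * (f : (L → Spacetime) → ℂ) x,
    (Complex.ofRealCLM.contDiff.comp χ.contDiff).mul (contDiff_smoothFun f)⟩
  refine ⟨g, (χ.hasCompactSupport.comp_left (g := ((↑) : ℝ → ℂ)) Complex.ofReal_zero).mul_right, ?_⟩
  ext1 x
  have hgf : (g : (L → Spacetime) → ℂ) =ᶠ[𝓝 (x : L → Spacetime)] (f : (L → Spacetime) → ℂ) := by
    filter_upwards [Metric.isOpen_ball.mem_nhds (hKR x.2)] with y hy
    simp [g, χ.one_of_mem_closedBall (Metric.ball_subset_closedBall hy)]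
  exact funext fun i => (hgf.iteratedFDeriv ℝ i).eq_of_nhds

theorem jet_mem_tensorJets (f : SmoothFun L) : jet K m f ∈ tensorJets K m := by
  obtain ⟨g, hg, hgf⟩ := exists_hasCompactSupport_jet_eq K m f
  have hclosed : IsClosed (tensorJets K m : Set (JetSpace K m)) :=
    Submodule.isClosed_topologicalClosure _
  rw [← hgf, ← SetLike.mem_coe, ← hclosed.closure_eq, Metric.mem_closure_iff]
  intro δ hδ
  obtain ⟨b, hb⟩ := exists_norm_jet_smoothConv_sub_le K m hg (half_pos hδ)
  refine ⟨_, jet_smoothConv_mem_tensorJets b hg, ?_⟩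
  rw [dist_comm, dist_eq_norm]
  linarith

theorem eq_zero_of_forall_tensorFun (u : CompactDistribution L)
    (hu : ∀ h : L → Config, evalDist u (tensorFun h) = 0) : u = 0 := by
  obtain ⟨u, K', m, M, hK, hbound⟩ := u
  let K : TopologicalSpace.Compacts (L → Spacetime) := ⟨K', hK⟩
  have hjet : ∀ f : SmoothFun L, ‖u f‖ ≤ |M| * ‖jet K m f‖ := fun f =>
    (hbound f ‖jet K m f‖ fun i hi x hx => norm_jet_apply_le f ⟨x, hx⟩ ⟨i, by omega⟩).trans
      (mul_le_mul_of_nonneg_right (le_abs_self M) (norm_nonneg _))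
  have hspan : tensorSpan L ≤ LinearMap.ker u := by
    rw [tensorSpan, Submodule.span_le]
    rintro _ ⟨h, rfl⟩
    simpa [evalDist, contDiff_tensorFun h] using hu h
  refine Subtype.ext (LinearMap.ext fun f => norm_le_zero_iff.1 ?_)
  refine le_of_forall_pos_le_add fun δ hδ => ?_
  obtain ⟨_, ⟨g, hg, rfl⟩, hd⟩ := Metric.mem_closure_iff.1 (jet_mem_tensorJets (K := K) (m := m) f)
    (δ / (|M| + 1)) (by positivity)
  have hug : u g = 0 := hspan hg
  calc ‖u f‖ = ‖u (f - g)‖ := by rw [map_sub, hug, sub_zero]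
    _ ≤ |M| * dist (jet K m f) (jet K m g) := by rw [dist_eq_norm, ← map_sub]; exact hjet _
    _ ≤ (|M| + 1) * (δ / (|M| + 1)) := by gcongr; linarith
    _ = 0 + δ := by rw [zero_add]; field_simp

end Jets

/-! ### The Leibniz rule for functionals -/

section Leibniz

variable {R A ι : Type*} [CommSemiring R] [CommSemiring A] [Algebra R A]

/-- The composition of the derivations `D i`, `i ∈ S`, of a commuting family. -/
def derivationProd (D : ι → Derivation R A A)
    (hD : ∀ i j, Commute (D i : A →ₗ[R] A) (D j : A →ₗ[R] A)) (S : Finset ι) : Module.End R A :=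
  S.noncommProd (fun i => (D i : A →ₗ[R] A)) fun i _ j _ _ => hD i j

variable {D : ι → Derivation R A A} {hD : ∀ i j, Commute (D i : A →ₗ[R] A) (D j : A →ₗ[R] A)}

theorem derivationProd_empty (a : A) : derivationProd D hD ∅ a = a := by
  exact congrArg (fun f : Module.End R A => f a) (Finset.noncommProd_empty _ _)

theorem derivationProd_insert [DecidableEq ι] {i : ι} {S : Finset ι} (hi : i ∉ S) (a : A) :
    derivationProd D hD (insert i S) a = D i (derivationProd D hD S a) := by
  exact congrArg (fun f : Module.End R A => f a) (Finset.noncommProd_insert_of_notMem S i _ _ hi)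

theorem derivationProd_mul [DecidableEq ι] (S : Finset ι) (a b : A) :
    derivationProd D hD S (a * b) =
      ∑ T ∈ S.powerset, derivationProd D hD (S \ T) a * derivationProd D hD T b := by
  induction S using Finset.induction_on with
  | empty => simp [derivationProd_empty]
  | insert i S hi ih =>
    rw [derivationProd_insert hi, ih, map_sum, Finset.sum_powerset_insert hi,
      ← Finset.sum_add_distrib]
    refine Finset.sum_congr rfl fun T hT => ?_
    have hiT : i ∉ T := fun h => hi (Finset.mem_powerset.1 hT h)
    rw [Derivation.leibniz, smul_eq_mul, smul_eq_mul, Finset.insert_sdiff_of_notMem _ hiT,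
      Finset.insert_sdiff_insert, Finset.sdiff_insert_of_notMem hi, derivationProd_insert hiT,
      derivationProd_insert (by simp [hi]), add_comm, mul_comm (derivationProd D hD T b)]

end Leibniz

section SmoothAlong

variable (E 𝔸 : Type*) [AddCommGroup E] [Module ℝ E] [NormedCommRing 𝔸] [NormedAlgebra ℝ 𝔸]

/-- Functionals that are smooth along every finite-dimensional affine family. -/
def smoothAlong : Subalgebra ℝ (E → 𝔸) where
  carrier := {F | ∀ (φ : E) (n : ℕ) (h : Fin n → E),
    ContDiff ℝ ∞ fun s : Fin n → ℝ => F (φ + ∑ j, s j • h j)}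
  mul_mem' hF hG := fun φ n h => (hF φ n h).mul (hG φ n h)
  add_mem' hF hG := fun φ n h => (hF φ n h).add (hG φ n h)
  algebraMap_mem' _ := fun _ _ _ => contDiff_const

variable {E 𝔸} {L : Type*}

theorem contDiff_family [Fintype L] (F : smoothAlong E 𝔸) (φ : E) (h : L → E) :
    ContDiff ℝ ∞ fun s : L → ℝ => (F : E → 𝔸) (φ + ∑ j, s j • h j) := by
  let e := Fintype.equivFin L
  have hcomp := (F.2 φ _ (h ∘ e.symm)).comp
    (contDiff_pi.2 fun a => contDiff_apply ℝ ℝ (e.symm a) :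
      ContDiff ℝ ∞ fun (s : L → ℝ) (a : Fin (Fintype.card L)) => s (e.symm a))
  convert! hcomp using 1
  ext s
  rw [Function.comp_apply, ← e.symm.sum_comp]
  rfl

theorem deriv_family [Fintype L] [DecidableEq L] (F : smoothAlong E 𝔸) (φ : E) (h : L → E)
    (i : L) (s : L → ℝ) :
    deriv (fun t : ℝ => (F : E → 𝔸) (φ + ∑ j, s j • h j + t • h i)) 0 =
      fderiv ℝ (fun s : L → ℝ => (F : E → 𝔸) (φ + ∑ j, s j • h j)) s (Pi.single i 1) := by
  rw [← ((contDiff_family F φ h).differentiable (by simp) s).lineDeriv_eq_fderiv, lineDeriv]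
  congr! 3
  simp only [Pi.add_apply, Pi.smul_apply, add_smul, Finset.sum_add_distrib, smul_assoc, add_assoc]
  rw [← Finset.smul_sum]
  simp [Pi.single_apply, ite_smul]

theorem differentiableAt_line (F : smoothAlong E 𝔸) (φ h : E) :
    DifferentiableAt ℝ (fun t : ℝ => (F : E → 𝔸) (φ + t • h)) 0 := by
  have hline := (contDiff_family F φ fun _ : Unit => h).comp
    (contDiff_pi.2 fun _ => contDiff_id : ContDiff ℝ ∞ fun (t : ℝ) (_ : Unit) => t)
  simp only [Function.comp_def, Finset.univ_unique, Finset.sum_singleton] at hline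
  exact hline.differentiable (by simp) 0

theorem deriv_line_mem_smoothAlong (F : smoothAlong E 𝔸) (k : E) :
    (fun φ => deriv (fun t : ℝ => (F : E → 𝔸) (φ + t • k)) 0) ∈ smoothAlong E 𝔸 := by
  intro φ n h
  have hfam : ∀ s : Fin n → ℝ,
      deriv (fun t : ℝ => (F : E → 𝔸) (φ + ∑ j, s j • h j + t • k)) 0 =
        fderiv ℝ (fun s : Option (Fin n) → ℝ => (F : E → 𝔸) (φ + ∑ j, s j • (j.elim k h : E)))
          (fun j => j.elim 0 s) (Pi.single none 1) := fun s => by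
    rw [← deriv_family]
    simp
  simp only [hfam]
  refine ContDiff.clm_apply (((contDiff_family F φ _).fderiv_right (m := ∞) (by simp)).comp
    (contDiff_pi.2 ?_)) contDiff_const
  rintro (_ | j)
  · exact contDiff_const
  · exact contDiff_apply ℝ ℝ j

variable (𝔸) in
/-- The derivative of functionals in the direction `h`. -/
def dirDerivation (h : E) : Derivation ℝ (smoothAlong E 𝔸) (smoothAlong E 𝔸) :=
  Derivation.mk'
    { toFun := fun F => ⟨_, deriv_line_mem_smoothAlong F h⟩
      map_add' := fun F G => Subtype.ext (funext fun φ =>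
        deriv_fun_add (differentiableAt_line F φ h) (differentiableAt_line G φ h))
      map_smul' := fun c F => Subtype.ext (funext fun φ =>
        deriv_fun_const_smul c (differentiableAt_line F φ h)) }
    fun F G => Subtype.ext (funext fun φ => by
      have hmul := deriv_fun_mul (differentiableAt_line F φ h) (differentiableAt_line G φ h)
      simp only [zero_smul, add_zero] at hmul
      refine hmul.trans ?_
      rw [add_comm, mul_comm (deriv _ _)]
      rfl)

theorem dirDerivation_family [Fintype L] [DecidableEq L] (F : smoothAlong E 𝔸) (φ : E)
    (h : L → E) (i : L) (s : L → ℝ) :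
    (dirDerivation 𝔸 (h i) F : E → 𝔸) (φ + ∑ j, s j • h j) =
      fderiv ℝ (fun s : L → ℝ => (F : E → 𝔸) (φ + ∑ j, s j • h j)) s (Pi.single i 1) :=
  deriv_family F φ h i s

theorem dirDerivation_dirDerivation_family [Fintype L] [DecidableEq L] (F : smoothAlong E 𝔸)
    (φ : E) (h : L → E) (i j : L) :
    (dirDerivation 𝔸 (h i) (dirDerivation 𝔸 (h j) F) : E → 𝔸) φ =
      fderiv ℝ (fderiv ℝ fun s : L → ℝ => (F : E → 𝔸) (φ + ∑ j, s j • h j)) 0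
        (Pi.single i 1) (Pi.single j 1) := by
  have hdiff : DifferentiableAt ℝ
      (fderiv ℝ fun s : L → ℝ => (F : E → 𝔸) (φ + ∑ j, s j • h j)) 0 :=
    ((contDiff_family F φ h).fderiv_right (m := 1) (by norm_cast)).differentiable (by simp) _
  have hbase : φ = φ + ∑ l, (0 : L → ℝ) l • h l := by simp
  conv_lhs => rw [hbase]
  rw [dirDerivation_family (dirDerivation 𝔸 (h j) F) φ h i 0]
  simp only [dirDerivation_family F]
  rw [fderiv_clm_apply hdiff (differentiableAt_const _)]
  simp

theorem dirDerivation_commute (h k : E) :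
    Commute (dirDerivation 𝔸 h : smoothAlong E 𝔸 →ₗ[ℝ] smoothAlong E 𝔸) (dirDerivation 𝔸 k) := by
  refine LinearMap.ext fun F => Subtype.ext (funext fun φ => ?_)
  let p : Bool → E := fun b => if b then h else k
  refine (dirDerivation_dirDerivation_family F φ p true false).trans
    (Eq.trans ?_ (dirDerivation_dirDerivation_family F φ p false true).symm)
  refine ContDiffAt.isSymmSndFDerivAt (n := ∞) (contDiff_family F φ p).contDiffAt ?_ _ _
  rw [minSmoothness_of_isRCLikeNormedField]
  exact WithTop.coe_le_coe.2 (le_top : (2 : ℕ∞) ≤ ⊤)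

variable (𝔸) in
/-- The iterated derivative of functionals in the directions `h j`, `j ∈ S`. -/
abbrev iterDir (h : L → E) (S : Finset L) : Module.End ℝ (smoothAlong E 𝔸) :=
  derivationProd (fun j => dirDerivation 𝔸 (h j)) (fun _ _ => dirDerivation_commute _ _) S

theorem iterDir_map {L' : Type*} (h : L → E) (ι : L' ↪ L) (S : Finset L') (F : smoothAlong E 𝔸) :
    iterDir 𝔸 h (S.map ι) F = iterDir 𝔸 (h ∘ ι) S F := by
  classical
  induction S using Finset.induction_on with
  | empty => simp [derivationProd_empty]
  | insert a S ha ih =>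
    rw [Finset.map_insert, derivationProd_insert (by simpa using ha), derivationProd_insert ha, ih]
    rfl

theorem iteratedFDeriv_family [Fintype L] [DecidableEq L] (F : smoothAlong E 𝔸) (φ : E)
    (h : L → E) (n : ℕ) (i : Fin n → L) (s : L → ℝ) :
    iteratedFDeriv ℝ n (fun s : L → ℝ => (F : E → 𝔸) (φ + ∑ j, s j • h j)) s
        (fun a => Pi.single (i a) 1) =
      (iterDir 𝔸 (h ∘ i) Finset.univ F : E → 𝔸) (φ + ∑ j, s j • h j) := by
  induction n generalizing s with
  | zero => simp [derivationProd_empty]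
  | succ n ih =>
    have hdiff : DifferentiableAt ℝ
        (iteratedFDeriv ℝ n fun s : L → ℝ => (F : E → 𝔸) (φ + ∑ j, s j • h j)) s :=
      ((contDiff_family F φ h).iteratedFDeriv_right (m := 1)
        (by exact_mod_cast le_top)).differentiable (by simp) s
    have hsucc : iterDir 𝔸 (h ∘ i) Finset.univ F =
        dirDerivation 𝔸 (h (i 0)) (iterDir 𝔸 (h ∘ i ∘ Fin.succ) Finset.univ F) := by
      rw [Fin.univ_succ, Finset.cons_eq_insert, derivationProd_insert (by simp), iterDir_map]
      rfl
    rw [iteratedFDeriv_succ_apply_left, hsucc, dirDerivation_family]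
    have hih := funext (ih (i ∘ Fin.succ))
    rw [← hih]
    exact (fderiv_continuousMultilinear_apply_const_apply hdiff _ _).symm

end SmoothAlong

section FunctionalDerivatives

variable {L : Type} (F : smoothAlong Config ℂ) (φ : Config) (h : L → Config)

theorem dirDeriv_eq_iterDir [Fintype L] :
    dirDeriv F φ h = (iterDir ℂ h Finset.univ F : Functional) φ := by
  classical
  have hfam := iteratedFDeriv_family F φ h _ (Fintype.equivFin L).symm 0
  rw [← Equiv.coe_toEmbedding, ← iterDir_map, Finset.map_univ_equiv] at hfam
  simp only [Pi.zero_apply, zero_smul, Finset.sum_const_zero, add_zero] at hfam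
  exact hfam

theorem dirDeriv_subtype [Fintype L] (p : L → Prop) [DecidablePred p] :
    dirDeriv F φ (fun j : {j // p j} => h j) =
      (iterDir ℂ h (Finset.univ.filter p) F : Functional) φ := by
  have hmap : Finset.univ.map (Function.Embedding.subtype p) = Finset.univ.filter p := by
    ext x
    simp
  rw [dirDeriv_eq_iterDir, ← hmap, iterDir_map]
  rfl

theorem iterDir_eq_zero_of_isFunctionalDeriv_zero {S : Finset L}
    (hF : IsFunctionalDeriv F φ (0 : CompactDistribution (Fin S.card))) :
    (iterDir ℂ h S F : Functional) φ = 0 := by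
  let ι : Fin S.card ↪ L := S.equivFin.symm.toEmbedding.trans (Function.Embedding.subtype _)
  have hι : Finset.univ.map ι = S := by
    rw [← Finset.map_map, Finset.map_univ_equiv]
    ext x
    simp
  rw [← hι, iterDir_map, ← dirDeriv_eq_iterDir, ← hF]
  simp [evalDist]

end FunctionalDerivatives

/-! ### Contractions along multigraphs -/

section Relabelling

variable {L L' : Type} [Fintype L] [Fintype L']

/-- Relabelling of the arguments of functions on `𝕄₂^L` along a bijection. -/
def relabel (σ : L ≃ L') : (L → Spacetime) ≃ₗᵢ[ℝ] (L' → Spacetime) where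
  toLinearEquiv := LinearEquiv.funCongrLeft ℝ Spacetime σ.symm
  norm_map' x := by
    change ‖x ∘ σ.symm‖ = ‖x‖
    refine le_antisymm ((pi_norm_le_iff_of_nonneg (norm_nonneg _)).2 fun j => norm_le_pi_norm x _)
      ((pi_norm_le_iff_of_nonneg (norm_nonneg _)).2 fun j => ?_)
    simpa using norm_le_pi_norm (x ∘ σ.symm) (σ j)

theorem relabel_apply (σ : L ≃ L') (x : L → Spacetime) (j : L') :
    relabel σ x j = x (σ.symm j) := rfl

theorem tensorFun_relabel (σ : L ≃ L') (h : L' → Config) (x : L → Spacetime) :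
    tensorFun h (relabel σ x) = tensorFun (h ∘ σ) x := by
  simp only [tensorFun, relabel_apply, Function.comp_apply]
  rw [← σ.prod_comp]
  simp only [Equiv.symm_apply_apply]

/-- The pullback of smooth functions along `relabel`. -/
def SmoothFun.relabel (σ : L ≃ L') : SmoothFun L' →ₗ[ℂ] SmoothFun L where
  toFun f := ⟨fun x => (f : (L' → Spacetime) → ℂ) (PAQFT.relabel σ x),
    (contDiff_smoothFun f).comp (PAQFT.relabel σ).contDiff⟩
  map_add' _ _ := rfl
  map_smul' _ _ := rfl

/-- The pushforward of compactly supported distributions along `relabel`. -/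
def CompactDistribution.relabel (σ : L ≃ L') (w : CompactDistribution L) :
    CompactDistribution L' :=
  ⟨(w : SmoothFun L →ₗ[ℂ] ℂ) ∘ₗ SmoothFun.relabel σ, by
    obtain ⟨w, K, m, M, hK, hw⟩ := w
    refine ⟨PAQFT.relabel σ '' K, m, M, hK.image (PAQFT.relabel σ).continuous, fun f b hb => ?_⟩
    refine hw _ b fun i hi x hx => (le_of_eq ?_).trans (hb i hi _ ⟨x, hx, rfl⟩)
    exact (PAQFT.relabel σ).norm_iteratedFDeriv_comp_right (f : (L' → Spacetime) → ℂ) x i⟩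

theorem evalDist_relabel (σ : L ≃ L') (w : CompactDistribution L) (f : (L' → Spacetime) → ℂ) :
    evalDist (CompactDistribution.relabel σ w) f = evalDist w fun x => f (relabel σ x) := by
  have hiff : ContDiff ℝ ∞ (fun x => f (relabel σ x)) ↔ ContDiff ℝ ∞ f :=
    (relabel σ).toContinuousLinearEquiv.contDiff_comp_iff
  by_cases hf : ContDiff ℝ ∞ f
  · rw [evalDist, evalDist, dif_pos hf, dif_pos (hiff.2 hf)]
    rfl
  · rw [evalDist, evalDist, dif_neg hf, dif_neg (hiff.not.2 hf)]

end Relabelling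

section TensorDerivative

variable {L : Type} [Fintype L] {n : ℕ}

theorem evalDist_sub (u v : CompactDistribution L) (f : (L → Spacetime) → ℂ) :
    evalDist (u - v) f = evalDist u f - evalDist v f := by
  unfold evalDist
  split_ifs <;> simp

theorem evalDist_sum {ι : Type*} (s : Finset ι) (u : ι → CompactDistribution L)
    (f : (L → Spacetime) → ℂ) : evalDist (∑ i ∈ s, u i) f = ∑ i ∈ s, evalDist (u i) f := by
  unfold evalDist
  split_ifs <;> simp

/-- The value of `⨂_i δ^{n_i}F_i/δφ^{n_i}` on `⨂_j h_j`, where the leg `j` is attached to the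
factor `F_{v j}`. -/
def tensorDirDeriv (F : Fin n → Functional) (v : L → Fin n) (φ : Config) (h : L → Config) : ℂ :=
  ∏ i, dirDeriv (F i) φ (fun j : {j : L // v j = i} => h j)

theorem tensorDirDeriv_eq_prod_iterDir (F : Fin n → smoothAlong Config ℂ) (v : L → Fin n)
    (φ : Config) (h : L → Config) :
    tensorDirDeriv (fun i => F i) v φ h =
      ∏ i, (iterDir ℂ h (Finset.univ.filter fun j => v j = i) (F i) : Functional) φ :=
  Finset.prod_congr rfl fun i _ => dirDeriv_subtype (F i) φ h fun j => v j = i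

theorem tensorDirDeriv_comp_equiv {L' : Type} [Fintype L'] (F : Fin n → smoothAlong Config ℂ)
    (σ : L ≃ L') (v : L' → Fin n) (φ : Config) (h : L' → Config) :
    tensorDirDeriv (fun i => F i) (v ∘ σ) φ (h ∘ σ) = tensorDirDeriv (fun i => F i) v φ h := by
  simp only [tensorDirDeriv_eq_prod_iterDir]
  refine Finset.prod_congr rfl fun i _ => ?_
  have hmap : (Finset.univ.filter fun j => (v ∘ σ) j = i).map σ.toEmbedding =
      Finset.univ.filter fun j => v j = i := by
    ext j
    simp
  rw [← hmap, iterDir_map]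
  rfl

theorem IsTensorDeriv.unique {F : Fin n → Functional} {v : L → Fin n} {φ : Config}
    {w w' : CompactDistribution L} (hw : IsTensorDeriv F v φ w) (hw' : IsTensorDeriv F v φ w') :
    w = w' := by
  refine sub_eq_zero.1 (eq_zero_of_forall_tensorFun _ fun h => ?_)
  rw [evalDist_sub, hw h, hw' h, sub_self]

end TensorDerivative

section HasContraction

variable {Δ : Bidistribution} {n : ℕ} {κ : Type} [Fintype κ] {φ : Config} {z z' : ℂ}

theorem exists_isMollifier : ∃ ρ : Spacetime → ℝ, IsMollifier ρ :=
  let b : ContDiffBump (0 : Spacetime) := ⟨1, 2, one_pos, one_lt_two⟩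
  ⟨b.normed volume, b.contDiff_normed, b.hasCompactSupport_normed, b.nonneg_normed,
    b.integral_normed⟩

theorem HasContraction.unique {F : Fin n → Functional} {src tgt : κ → Fin n}
    (h : HasContraction Δ F src tgt φ z) (h' : HasContraction Δ F src tgt φ z') : z = z' := by
  obtain ⟨w, hw, hz⟩ := h
  obtain ⟨w', hw', hz'⟩ := h'
  obtain rfl := hw.unique hw'
  obtain ⟨ρ, hρ⟩ := exists_isMollifier
  exact tendsto_nhds_unique (hz ρ hρ) (hz' ρ hρ)

theorem HasContraction.contraction_eq {F : Fin n → Functional} {src tgt : κ → Fin n}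
    (h : HasContraction Δ F src tgt φ z) : contraction Δ F src tgt φ = z := by
  have hex : ∃ z, HasContraction Δ F src tgt φ z := ⟨z, h⟩
  rw [contraction, dif_pos hex]
  exact hex.choose_spec.unique h

theorem hasContraction_contraction {F : Fin n → Functional} {src tgt : κ → Fin n}
    (h : ∃ z, HasContraction Δ F src tgt φ z) :
    HasContraction Δ F src tgt φ (contraction Δ F src tgt φ) := by
  obtain ⟨z, hz⟩ := h
  rwa [hz.contraction_eq]

theorem HasContraction.sum {ι : Type*} {s : Finset ι} {m : ℕ} {F : Fin n → Functional}
    {src tgt : κ → Fin n} {G : ι → Fin m → Functional} {src' tgt' : ι → κ → Fin m}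
    {z : ι → ℂ} (hz : ∀ i ∈ s, HasContraction Δ (G i) (src' i) (tgt' i) φ (z i))
    (hF : ∀ h, tensorDirDeriv F (Sum.elim src tgt) φ h =
      ∑ i ∈ s, tensorDirDeriv (G i) (Sum.elim (src' i) (tgt' i)) φ h) :
    HasContraction Δ F src tgt φ (∑ i ∈ s, z i) := by
  choose! w hw hz using hz
  refine ⟨∑ i ∈ s, w i, fun h => ?_, fun ρ hρ => ?_⟩
  · rw [evalDist_sum, Finset.sum_congr rfl fun i hi => hw i hi h]
    exact (hF h).symm
  · simp only [evalDist_sum]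
    exact tendsto_finsetSum _ fun i hi => hz i hi ρ hρ

theorem HasContraction.of_tensorDirDeriv_eq_zero {F : Fin n → Functional} {src tgt : κ → Fin n}
    (hF : ∀ h, tensorDirDeriv F (Sum.elim src tgt) φ h = 0) :
    HasContraction Δ F src tgt φ 0 :=
  HasContraction.sum (s := (∅ : Finset Empty)) (G := fun _ => F)
    (src' := fun _ => src) (tgt' := fun _ => tgt) (z := 0) (by simp) (by simpa using hF)

theorem HasContraction.comp_equiv {κ' : Type} [Fintype κ'] {F : Fin n → smoothAlong Config ℂ}
    (σ : κ ≃ κ') {src tgt : κ' → Fin n}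
    (h : HasContraction Δ (fun i => F i) (src ∘ σ) (tgt ∘ σ) φ z) :
    HasContraction Δ (fun i => F i) src tgt φ z := by
  obtain ⟨w, hw, hz⟩ := h
  have hlegs : Sum.elim (src ∘ σ) (tgt ∘ σ) = Sum.elim src tgt ∘ σ.sumCongr σ := by
    ext (j | j) <;> rfl
  rw [hlegs] at hw
  refine ⟨CompactDistribution.relabel (σ.sumCongr σ) w, fun h => ?_,
    fun ρ hρ => (hz ρ hρ).congr fun ε => ?_⟩
  · simp only [evalDist_relabel, tensorFun_relabel]
    exact (hw _).trans (tensorDirDeriv_comp_equiv F _ _ φ h)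
  · simp only [evalDist_relabel, relabel_apply, ← σ.prod_comp]
    simp

end HasContraction

section GraphContraction

variable {Δ : Bidistribution} {n : ℕ} {κ κ' : Type} [Fintype κ] [Fintype κ']

theorem exists_equiv_comp_eq_of_map_eq {α β Z : Type*} [Fintype α] [Fintype β] {f : α → Z}
    {g : β → Z} (h : Finset.univ.val.map f = Finset.univ.val.map g) :
    ∃ e : α ≃ β, g ∘ e = f := by
  classical
  have hfiber : ∀ z, Nonempty ({a // f a = z} ≃ {b // g b = z}) := fun z => by
    have hcount := congrArg (Multiset.count z) h
    simp only [Multiset.count_map, eq_comm (a := z)] at hcount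
    exact ⟨Fintype.equivOfCardEq (by rw [Fintype.card_subtype, Fintype.card_subtype]; exact hcount)⟩
  exact ⟨Equiv.ofFiberEquiv fun z => (hfiber z).some,
    funext fun a => Equiv.ofFiberEquiv_map _ a⟩

/-- The multigraph with edges from `src a` to `tgt a`, as a multiset of pairs of vertices. -/
def edgeMultiset (src tgt : κ → Fin n) : Multiset (Fin n × Fin n) :=
  ∑ a, {(src a, tgt a)}

theorem edgeMultiset_eq_map (src tgt : κ → Fin n) :
    edgeMultiset src tgt = Finset.univ.val.map fun a => (src a, tgt a) := by
  rw [← Multiset.sum_map_singleton (Multiset.map _ _), Multiset.map_map]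
  rfl

theorem hasContraction_iff_of_edgeMultiset_eq {F : Fin n → smoothAlong Config ℂ}
    {src tgt : κ → Fin n} {src' tgt' : κ' → Fin n}
    (h : edgeMultiset src tgt = edgeMultiset src' tgt') (φ : Config) (z : ℂ) :
    HasContraction Δ (fun i => F i) src tgt φ z ↔
      HasContraction Δ (fun i => F i) src' tgt' φ z := by
  rw [edgeMultiset_eq_map, edgeMultiset_eq_map] at h
  obtain ⟨σ, hσ⟩ := exists_equiv_comp_eq_of_map_eq h
  have hsrc : src = src' ∘ σ := funext fun a => (congrArg Prod.fst (congrFun hσ a)).symm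
  have htgt : tgt = tgt' ∘ σ := funext fun a => (congrArg Prod.snd (congrFun hσ a)).symm
  subst hsrc htgt
  refine ⟨HasContraction.comp_equiv σ, fun h => HasContraction.comp_equiv σ.symm ?_⟩
  simpa only [Function.comp_assoc, Equiv.self_comp_symm, Function.comp_id] using h

theorem contraction_eq_of_edgeMultiset_eq {F : Fin n → smoothAlong Config ℂ}
    {src tgt : κ → Fin n} {src' tgt' : κ' → Fin n}
    (h : edgeMultiset src tgt = edgeMultiset src' tgt') :
    contraction Δ (fun i => F i) src tgt = contraction Δ (fun i => F i) src' tgt' := by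
  have hpred : HasContraction Δ (fun i => F i) src tgt =
      HasContraction Δ (fun i => F i) src' tgt' :=
    funext fun φ => funext fun z => propext (hasContraction_iff_of_edgeMultiset_eq h φ z)
  unfold contraction
  rw [hpred]

variable (Δ) in
/-- The contraction along a multigraph with vertices the factors. -/
def graphContraction (F : Fin n → PowerSeries Functional) (M : Multiset (Fin n × Fin n)) :
    PowerSeries Functional :=
  contractionSeries Δ F (fun a : M => (a : Fin n × Fin n).1) fun a : M => (a : Fin n × Fin n).2

theorem edgeMultiset_coe (M : Multiset (Fin n × Fin n)) :
    edgeMultiset (fun a : M => (a : Fin n × Fin n).1) (fun a : M => (a : Fin n × Fin n).2) = M := by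
  rw [edgeMultiset_eq_map]
  exact Multiset.map_univ_coe M

theorem contractionSeries_eq_graphContraction {F : Fin n → PowerSeries Functional}
    (hF : ∀ i k, PowerSeries.coeff k (F i) ∈ smoothAlong Config ℂ) (src tgt : κ → Fin n) :
    contractionSeries Δ F src tgt = graphContraction Δ F (edgeMultiset src tgt) :=
  congrArg PowerSeries.mk (funext fun _ => Finset.sum_congr rfl fun k _ =>
    contraction_eq_of_edgeMultiset_eq (F := fun i => ⟨_, hF i (k i)⟩) (edgeMultiset_coe _).symm)

theorem contractionDefined_of_edgeMultiset_eq {F : Fin n → PowerSeries Functional}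
    (hF : ∀ i k, PowerSeries.coeff k (F i) ∈ smoothAlong Config ℂ) {src tgt : κ → Fin n}
    {src' tgt' : κ' → Fin n} (h : edgeMultiset src tgt = edgeMultiset src' tgt')
    (hdef : ContractionDefined Δ F src' tgt') : ContractionDefined Δ F src tgt := fun k φ =>
  (hdef k φ).imp fun z =>
    (hasContraction_iff_of_edgeMultiset_eq (F := fun i => ⟨_, hF i (k i)⟩) h φ z).2

end GraphContraction

/-! ### Contractions with a product -/

section Product

variable {l : ℕ}

theorem sum_powerset_eq_sum_predAbove_comp {L M : Type*} [Fintype L] [DecidableEq L]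
    [AddCommMonoid M] (v : L → Fin (l + 1))
    (g : (Fin l → Finset L) → Finset L → Finset L → M) :
    ∑ T ∈ (Finset.univ.filter fun j => v j = Fin.last l).powerset,
        g (fun t => Finset.univ.filter fun j => v j = t.castSucc)
          ((Finset.univ.filter fun j => v j = Fin.last l) \ T) T =
      ∑ u : L → Fin (l + 2) with (Fin.last l).predAbove ∘ u = v,
        g (fun t => Finset.univ.filter fun j => u j = t.castSucc.castSucc)
          (Finset.univ.filter fun j => u j = (Fin.last l).castSucc)
          (Finset.univ.filter fun j => u j = Fin.last (l + 1)) := by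
  refine (Finset.sum_nbij' (fun u => Finset.univ.filter fun j => u j = Fin.last (l + 1))
    (fun T j => if j ∈ T then Fin.last (l + 1) else (v j).castSucc) ?_ ?_ ?_ ?_ ?_).symm
  · intro u hu
    obtain rfl := (Finset.mem_filter.1 hu).2
    refine Finset.mem_powerset.2 fun j hj => ?_
    have hj : u j = Fin.last (l + 1) := by simpa using hj
    simp [hj]
  · intro T hT
    refine Finset.mem_filter.2 ⟨Finset.mem_univ _, funext fun j => ?_⟩
    by_cases hj : j ∈ T
    · simpa [hj, eq_comm] using Finset.mem_powerset.1 hT hj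
    · simp [hj]
  · intro u hu
    obtain rfl := (Finset.mem_filter.1 hu).2
    ext1 j
    rcases Fin.eq_castSucc_or_eq_last (u j) with ⟨q, hq⟩ | hq <;> simp [hq]
  · intro T _
    ext j
    simp [Fin.castSucc_ne_last]
  · intro u hu
    obtain rfl := (Finset.mem_filter.1 hu).2
    congr 1
    · ext t j
      rcases Fin.eq_castSucc_or_eq_last (u j) with ⟨q, hq⟩ | hq <;> simp [hq, eq_comm]
    · ext j
      rcases Fin.eq_castSucc_or_eq_last (u j) with ⟨q, hq⟩ | hq <;>
        simp [hq, (Fin.castSucc_ne_last _).symm]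

theorem tensorDirDeriv_snoc_sum_mul {L : Type} [Fintype L] [DecidableEq L] {ι : Type*}
    (s : Finset ι) (A : Fin l → smoothAlong Config ℂ) (B C : ι → smoothAlong Config ℂ)
    (v : L → Fin (l + 1)) (φ : Config) (h : L → Config) :
    tensorDirDeriv (fun q => ((A▹∑ i ∈ s, B i * C i) q : Functional)) v φ h =
      ∑ i ∈ s, ∑ u : L → Fin (l + 2) with (Fin.last l).predAbove ∘ u = v,
        tensorDirDeriv (fun q => ((A▹B i▹C i) q : Functional)) u φ h := by
  simp only [tensorDirDeriv_eq_prod_iterDir, Fin.prod_univ_castSucc, Fin.snoc_castSucc,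
    Fin.snoc_last, map_sum, AddSubmonoidClass.coe_finsetSum, Finset.sum_apply, Finset.mul_sum]
  refine Finset.sum_congr rfl fun i _ => ?_
  rw [derivationProd_mul, ← sum_powerset_eq_sum_predAbove_comp v fun S S' T =>
    (∏ t, (iterDir ℂ h (S t) (A t) : Functional) φ) * (iterDir ℂ h S' (B i) : Functional) φ *
      (iterDir ℂ h T (C i) : Functional) φ]
  simp only [AddSubmonoidClass.coe_finsetSum, Finset.sum_apply, Finset.mul_sum, mul_assoc]
  rfl

/-- The edges between the `l + 2` factors `A_1, …, A_l, B, C` which become edges between the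
`l + 1` factors `A_1, …, A_l, B C` when `B` and `C` are merged. -/
abbrev SplitEdge (l : ℕ) : Type :=
  {p : Fin (l + 2) × Fin (l + 2) // (Fin.last l).predAbove p.1 < (Fin.last l).predAbove p.2}

/-- The edge obtained by merging the last two vertices. -/
def mergeEdge (p : SplitEdge l) : Pairs (l + 1) :=
  ⟨((Fin.last l).predAbove p.1.1, (Fin.last l).predAbove p.1.2), p.2⟩

theorem sum_mergeEdge_comp_eq_sum_predAbove_comp {κ M : Type*} [Fintype κ] [DecidableEq κ]
    [AddCommMonoid M] (e : κ → Pairs (l + 1)) (f : (κ ⊕ κ → Fin (l + 2)) → M) :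
    ∑ g : κ → SplitEdge l with mergeEdge ∘ g = e,
        f (Sum.elim (fun a => (g a).1.1) fun a => (g a).1.2) =
      ∑ u : κ ⊕ κ → Fin (l + 2) with (Fin.last l).predAbove ∘ u =
        Sum.elim (fun a => (e a).1.1) (fun a => (e a).1.2), f u := by
  refine Finset.sum_nbij (fun g => Sum.elim (fun a => (g a).1.1) fun a => (g a).1.2)
    ?_ ?_ ?_ fun _ _ => rfl
  · intro g hg
    obtain rfl := (Finset.mem_filter.1 hg).2
    exact Finset.mem_filter.2 ⟨Finset.mem_univ _, by ext1 (a | a) <;> rfl⟩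
  · intro g _ g' _ hgg'
    exact funext fun a => Subtype.ext
      (Prod.ext (congrFun hgg' (Sum.inl a)) (congrFun hgg' (Sum.inr a)))
  · intro u hu
    have hsrc := fun a => congrFun (Finset.mem_filter.1 hu).2 (Sum.inl a)
    have htgt := fun a => congrFun (Finset.mem_filter.1 hu).2 (Sum.inr a)
    simp only [Function.comp_apply, Sum.elim_inl, Sum.elim_inr] at hsrc htgt
    refine ⟨fun a => ⟨(u (Sum.inl a), u (Sum.inr a)), by rw [hsrc, htgt]; exact (e a).2⟩,
      Finset.mem_filter.2 ⟨Finset.mem_univ _, funext fun a => Subtype.ext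
        (Prod.ext (hsrc a) (htgt a))⟩, ?_⟩
    ext1 (a | a) <;> rfl

variable {Δ : Bidistribution} {κ : Type} [Fintype κ] [DecidableEq κ]

theorem HasContraction.snoc_sum_mul {ι : Type*} {s : Finset ι} {A : Fin l → smoothAlong Config ℂ}
    {B C : ι → smoothAlong Config ℂ} {e : κ → Pairs (l + 1)} {φ : Config}
    {z : ι → (κ → SplitEdge l) → ℂ}
    (hz : ∀ i ∈ s, ∀ g, mergeEdge ∘ g = e → HasContraction Δ
      (fun q => ((A▹B i▹C i) q : Functional))
      (fun a => (g a).1.1) (fun a => (g a).1.2) φ (z i g)) :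
    HasContraction Δ (fun q => ((A▹∑ i ∈ s, B i * C i) q : Functional))
      (fun a => (e a).1.1) (fun a => (e a).1.2) φ
      (∑ i ∈ s, ∑ g with mergeEdge ∘ g = e, z i g) := by
  rw [← Finset.sum_product']
  refine HasContraction.sum (G := fun x q => ((A▹B x.1▹C x.1) q : Functional))
    (src' := fun x a => (x.2 a).1.1) (tgt' := fun x a => (x.2 a).1.2)
    (fun x hx => ?_) fun h => ?_
  · rw [Finset.mem_product, Finset.mem_filter] at hx
    exact hz x.1 hx.1 x.2 hx.2.2
  · rw [tensorDirDeriv_snoc_sum_mul, Finset.sum_product]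
    exact Finset.sum_congr rfl fun i _ => (sum_mergeEdge_comp_eq_sum_predAbove_comp e fun u =>
      tensorDirDeriv (fun q => ((A▹B i▹C i) q : Functional)) u φ h).symm

theorem sum_piAntidiag_sum_antidiagonal_last {M : Type*} [AddCommMonoid M] (N : ℕ)
    (f : (Fin (l + 2) → ℕ) → M) :
    ∑ k ∈ Finset.piAntidiag (Finset.univ : Finset (Fin (l + 1))) N,
        ∑ p ∈ Finset.HasAntidiagonal.antidiagonal (k (Fin.last l)),
          f (Fin.init k▹p.1▹p.2) =
      ∑ k ∈ Finset.piAntidiag Finset.univ N, f k := by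
  rw [Finset.sum_sigma']
  refine Finset.sum_nbij' (fun x => Fin.init x.1▹x.2.1▹x.2.2)
    (fun k => ⟨Fin.init (Fin.init k)▹(k (Fin.last l).castSucc + k (Fin.last (l + 1))),
      k (Fin.last l).castSucc, k (Fin.last (l + 1))⟩) ?_ ?_ ?_ ?_ fun _ _ => rfl
  · rintro ⟨k, p⟩ hx
    simp_all [Fin.sum_univ_castSucc, Fin.init, add_assoc]
  · intro k hk
    simp_all [Fin.sum_univ_castSucc, Fin.init, add_assoc]
  · rintro ⟨k, p⟩ hx
    have hp : p.1 + p.2 = k (Fin.last l) := by simp_all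
    simp [hp]
  · intro k _
    simp only [Fin.init_snoc]
    exact (congrArg (·▹k (Fin.last (l + 1))) (Fin.snoc_init_self _)).trans
      (Fin.snoc_init_self _)

variable {A : Fin l → PowerSeries Functional} {B C : PowerSeries Functional}
  {e : κ → Pairs (l + 1)}

theorem hasContraction_snoc_mul (hA : ∀ t k, PowerSeries.coeff k (A t) ∈ smoothAlong Config ℂ)
    (hB : ∀ k, PowerSeries.coeff k B ∈ smoothAlong Config ℂ)
    (hC : ∀ k, PowerSeries.coeff k C ∈ smoothAlong Config ℂ)
    (hdef : ∀ g, mergeEdge ∘ g = e →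
      ContractionDefined Δ (A▹B▹C) (fun a => (g a).1.1) fun a => (g a).1.2)
    (k : Fin (l + 1) → ℕ) (φ : Config) :
    HasContraction Δ (fun q => PowerSeries.coeff (k q) ((A▹(B * C)) q))
      (fun a => (e a).1.1) (fun a => (e a).1.2) φ
      (∑ p ∈ Finset.HasAntidiagonal.antidiagonal (k (Fin.last l)), ∑ g with mergeEdge ∘ g = e,
        contraction Δ
          (fun q => PowerSeries.coeff ((Fin.init k▹p.1▹p.2) q) ((A▹B▹C) q))
          (fun a => (g a).1.1) (fun a => (g a).1.2) φ) := by
  have hsnoc : (fun q => PowerSeries.coeff (k q) ((A▹(B * C)) q)) = fun q =>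
      (((fun t => ⟨_, hA t (k t.castSucc)⟩ : Fin l → smoothAlong Config ℂ)▹
        ∑ p ∈ Finset.HasAntidiagonal.antidiagonal (k (Fin.last l)),
          ⟨_, hB p.1⟩ * ⟨_, hC p.2⟩) q : Functional) := by
    ext1 q
    cases q using Fin.lastCases <;>
      simp [PowerSeries.coeff_mul, AddSubmonoidClass.coe_finsetSum]
  rw [hsnoc]
  refine HasContraction.snoc_sum_mul fun p _ g hg => ?_
  convert! hasContraction_contraction (hdef g hg (Fin.init k▹p.1▹p.2) φ) using 1
  ext1 q
  cases q using Fin.lastCases with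
  | last => simp
  | cast q => cases q using Fin.lastCases <;> simp [Fin.init]

theorem contractionSeries_snoc_mul
    (hA : ∀ t k, PowerSeries.coeff k (A t) ∈ smoothAlong Config ℂ)
    (hB : ∀ k, PowerSeries.coeff k B ∈ smoothAlong Config ℂ)
    (hC : ∀ k, PowerSeries.coeff k C ∈ smoothAlong Config ℂ)
    (hdef : ∀ g, mergeEdge ∘ g = e →
      ContractionDefined Δ (A▹B▹C) (fun a => (g a).1.1) fun a => (g a).1.2) :
    contractionSeries Δ (A▹(B * C)) (fun a => (e a).1.1) (fun a => (e a).1.2) =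
      ∑ g with mergeEdge ∘ g = e,
        contractionSeries Δ (A▹B▹C) (fun a => (g a).1.1) fun a => (g a).1.2 := by
  ext N φ
  simp only [map_sum, contractionSeries, PowerSeries.coeff_mk]
  rw [Finset.sum_comm, ← sum_piAntidiag_sum_antidiagonal_last]
  simp only [Finset.sum_apply, (hasContraction_snoc_mul hA hB hC hdef _ φ).contraction_eq]

end Product

/-! ### Counting words -/

section Words

theorem inv_factorial_smul_add_pow_eq_sum {R Y : Type*} [CommRing R] [Algebra ℂ R] [Fintype Y]
    [DecidableEq Y] (x : R) (y : Y → R) (m : ℕ) :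
    (m.factorial : ℂ)⁻¹ • (x + ∑ t, y t) ^ m =
      ∑ i ∈ Finset.range (m + 1), ∑ d ∈ Finset.piAntidiag Finset.univ i,
        (∏ t, ((d t).factorial : ℂ))⁻¹ • ((m - i).factorial : ℂ)⁻¹ •
          (x ^ (m - i) * ∏ t, y t ^ d t) := by
  rw [add_comm, add_pow, Finset.smul_sum]
  refine Finset.sum_congr rfl fun i hi => ?_
  rw [Finset.sum_pow_eq_sum_piAntidiag, Finset.sum_mul, Finset.sum_mul, Finset.smul_sum]
  refine Finset.sum_congr rfl fun d hd => ?_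
  have hfactorial : (m.choose i : ℂ) * ((∏ t, ((d t).factorial : ℂ)) *
      Nat.multinomial Finset.univ d) * (m - i).factorial = m.factorial := by
    have hmul := Nat.multinomial_spec Finset.univ d
    rw [(Finset.mem_piAntidiag.1 hd).1] at hmul
    have hchoose := Nat.choose_mul_factorial_mul_factorial (Finset.mem_range_succ_iff.1 hi)
    rw [← hmul] at hchoose
    exact_mod_cast hchoose
  have hscalar : (m.factorial : ℂ)⁻¹ * (Nat.multinomial Finset.univ d * m.choose i : ℕ) =
      (∏ t, ((d t).factorial : ℂ))⁻¹ * ((m - i).factorial : ℂ)⁻¹ := by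
    have hprod : (∏ t, ((d t).factorial : ℂ)) ≠ 0 :=
      Finset.prod_ne_zero_iff.2 fun t _ => Nat.cast_ne_zero.2 (d t).factorial_ne_zero
    have hm : (m.factorial : ℂ) ≠ 0 := Nat.cast_ne_zero.2 m.factorial_ne_zero
    have hmi : ((m - i).factorial : ℂ) ≠ 0 := Nat.cast_ne_zero.2 (m - i).factorial_ne_zero
    field_simp
    rw [← hfactorial]
    push_cast
    ring
  rw [smul_smul, ← hscalar, ← smul_smul, Nat.cast_smul_eq_nsmul, nsmul_eq_mul]
  push_cast
  ring_nf

theorem sum_map_ofAdd_pow {Z S R : Type*} [Fintype Z] [AddCommMonoid S] [CommSemiring R]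
    (χ : Multiplicative S →* R) (f : Z → S) (m : ℕ) :
    (∑ z, χ (.ofAdd (f z))) ^ m = ∑ g : Fin m → Z, χ (.ofAdd (∑ a, f (g a))) := by
  simp only [Fintype.sum_pow, ofAdd_sum, map_prod]

theorem inv_factorial_smul_sum_words {X Y S M : Type*} [Fintype X] [Fintype Y] [DecidableEq Y]
    [AddCommMonoid S] [AddCommGroup M] [Module ℂ M] (Φ : S → M) (x : X → S) (y : Y → S) (m : ℕ) :
    (m.factorial : ℂ)⁻¹ • ∑ g : Fin m → X ⊕ Y, Φ (∑ a, Sum.elim x y (g a)) =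
      ∑ i ∈ Finset.range (m + 1), ∑ d ∈ Finset.piAntidiag Finset.univ i,
        (∏ t, ((d t).factorial : ℂ))⁻¹ • ((m - i).factorial : ℂ)⁻¹ •
          ∑ e : Fin (m - i) → X, Φ (∑ a, x (e a) + ∑ t, d t • y t) := by
  -- The monoid algebra linearizes `Φ`, reducing the claim to the binomial and multinomial theorems.
  obtain ⟨χ, lift, hlift⟩ : ∃ (χ : Multiplicative S →* AddMonoidAlgebra ℂ S)
      (lift : AddMonoidAlgebra ℂ S →ₗ[ℂ] M), ∀ s, lift (χ (.ofAdd s)) = Φ s :=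
    ⟨AddMonoidAlgebra.of ℂ S, (AddMonoidAlgebra.basis S ℂ).constr ℂ Φ,
      (AddMonoidAlgebra.basis S ℂ).constr_basis ℂ Φ⟩
  have hbinomial := inv_factorial_smul_add_pow_eq_sum
    (∑ z, χ (.ofAdd (x z))) (fun t => χ (.ofAdd (y t))) m
  have hsum : ∑ z, χ (.ofAdd (x z)) + ∑ t, χ (.ofAdd (y t)) =
      ∑ z, χ (.ofAdd (Sum.elim x y z)) := by
    simp only [Fintype.sum_sum_type, Sum.elim_inl, Sum.elim_inr]
  have hmonomial : ∀ (s : S) (d : Y → ℕ), χ (.ofAdd s) * ∏ t, χ (.ofAdd (y t)) ^ d t =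
      χ (.ofAdd (s + ∑ t, d t • y t)) := fun s d => by
    simp only [ofAdd_add, ofAdd_sum, ofAdd_nsmul, map_mul, map_prod, map_pow]
  simp only [hsum, sum_map_ofAdd_pow, Finset.sum_mul, hmonomial] at hbinomial
  simpa only [map_sum, map_smul, hlift] using congrArg lift hbinomial

theorem exists_sum_sumElim_eq {X Y S : Type*} [Fintype Y] [AddCommMonoid S]
    (x : X → S) (y : Y → S) {m : ℕ} (g : Fin m → X ⊕ Y) :
    ∃ (n : ℕ) (e : Fin n → X) (d : Y → ℕ),
      ∑ a, Sum.elim x y (g a) = ∑ a, x (e a) + ∑ t, d t • y t := by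
  classical
  induction m with
  | zero => exact ⟨0, Fin.elim0, 0, by simp⟩
  | succ m ih =>
    obtain ⟨n, e, d, htail⟩ := ih (Fin.tail g)
    simp only [Fin.tail_def] at htail
    rw [Fin.sum_univ_succ, htail]
    rcases g 0 with p | t
    · refine ⟨n + 1, Fin.cons p e, d, ?_⟩
      simp only [Fin.sum_univ_succ, Fin.cons_zero, Fin.cons_succ, Sum.elim_inl, add_assoc]
    · refine ⟨n, e, Pi.single t 1 + d, ?_⟩
      have hd : ∑ s, (Pi.single t 1 + d : Y → ℕ) s • y s = y t + ∑ s, d s • y s := by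
        simp [add_smul, Finset.sum_add_distrib, Pi.single_apply]
      rw [hd, Sum.elim_inr, add_left_comm]

end Words

/-! ### Time-ordered products -/

section HbarSum

theorem coeff_hbarSum (a : ℕ → PowerSeries Functional) (N : ℕ) :
    PowerSeries.coeff N (hbarSum a) =
      ∑ j ∈ Finset.range (N + 1), PowerSeries.coeff (N - j) (a j) := by
  rw [hbarSum, PowerSeries.coeff_mk, map_sum]
  refine Finset.sum_congr rfl fun j hj => ?_
  rw [PowerSeries.coeff_X_pow_mul', if_pos (Finset.mem_range_succ_iff.1 hj)]

theorem hbarSum_smul (z : ℂ) (a : ℕ → PowerSeries Functional) :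
    hbarSum (fun m => z • a m) = z • hbarSum a := by
  ext1 N
  simp only [coeff_hbarSum, LinearMap.map_smul_of_tower, Finset.smul_sum]

theorem hbarSum_sum {ι : Type*} (s : Finset ι) (a : ι → ℕ → PowerSeries Functional) :
    hbarSum (fun m => ∑ i ∈ s, a i m) = ∑ i ∈ s, hbarSum (a i) := by
  ext1 N
  simp only [coeff_hbarSum, map_sum]
  exact Finset.sum_comm

theorem hbarSum_sum_range_diag (a : ℕ → ℕ → PowerSeries Functional) :
    hbarSum (fun m => ∑ i ∈ Finset.range (m + 1), a i (m - i)) =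
      hbarSum fun i => hbarSum (a i) := by
  ext1 N
  simp only [coeff_hbarSum, map_sum]
  have hflip := Finset.sum_range_diag_flip (N + 1)
    fun i m => PowerSeries.coeff (N - (i + m)) (a i m)
  refine Eq.trans ?_ (hflip.trans ?_)
  · refine Finset.sum_congr rfl fun m _ => Finset.sum_congr rfl fun i hi => ?_
    rw [Nat.add_sub_cancel' (Finset.mem_range_succ_iff.1 hi)]
  · refine Finset.sum_congr rfl fun i hi => ?_
    rw [Nat.sub_add_comm (Finset.mem_range_succ_iff.1 hi)]
    simp only [Nat.sub_sub]

theorem hbarSum_eq_sum_range {a : ℕ → PowerSeries Functional} {c : ℕ} (ha : ∀ i > c, a i = 0) :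
    hbarSum a = ∑ i ∈ Finset.range (c + 1), PowerSeries.X ^ i * a i := by
  ext1 N
  have hterm : ∀ i, N < i ∨ c < i → PowerSeries.coeff N (PowerSeries.X ^ i * a i) = 0 := by
    rintro i (hi | hi)
    · rw [PowerSeries.coeff_X_pow_mul', if_neg (not_le.2 hi)]
    · rw [ha i hi, mul_zero, map_zero]
  rw [hbarSum, PowerSeries.coeff_mk, map_sum, map_sum]
  calc ∑ i ∈ Finset.range (N + 1), PowerSeries.coeff N (PowerSeries.X ^ i * a i)
      = ∑ i ∈ Finset.range (max N c + 1), PowerSeries.coeff N (PowerSeries.X ^ i * a i) :=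
        Finset.sum_subset (Finset.range_subset_range.2 (by omega)) fun i _ hi =>
          hterm i (Or.inl (by simpa using hi))
    _ = ∑ i ∈ Finset.range (c + 1), PowerSeries.coeff N (PowerSeries.X ^ i * a i) :=
        (Finset.sum_subset (Finset.range_subset_range.2 (by omega)) fun i _ hi =>
          hterm i (Or.inr (by simpa using hi))).symm

end HbarSum

section Edges

variable {l : ℕ}

/-- An edge between the factors `A_1, …, A_l, B, C` which survives the merging of `B` and `C` either
joins two of the factors `A_1, …, A_l, B`, or joins some `A_t` to `C`. -/
def splitEdgeEquiv : Pairs (l + 1) ⊕ Fin l ≃ SplitEdge l :=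
  Equiv.ofBijective
    (Sum.elim (fun p => ⟨(p.1.1.castSucc, p.1.2.castSucc), by simpa using p.2⟩)
      fun t => ⟨(t.castSucc.castSucc, Fin.last (l + 1)), by simp⟩) <| by
    refine ⟨?_, fun ⟨⟨x, y⟩, hxy⟩ => ?_⟩
    · rintro (p | t) (p' | t') h
      · simpa [Subtype.ext_iff, Prod.ext_iff] using h
      · simp at h
      · simp [(Fin.castSucc_ne_last _).symm] at h
      · simpa using h
    · dsimp only at hxy
      rcases Fin.eq_castSucc_or_eq_last x with ⟨x, rfl⟩ | rfl
      · rcases Fin.eq_castSucc_or_eq_last y with ⟨y, rfl⟩ | rfl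
        · exact ⟨Sum.inl ⟨(x, y), by simpa using hxy⟩, rfl⟩
        · rcases Fin.eq_castSucc_or_eq_last x with ⟨t, rfl⟩ | rfl
          · exact ⟨Sum.inr t, rfl⟩
          · simp at hxy
      · exact absurd hxy (by simpa using Fin.le_last _)

theorem edgeMultiset_splitEdgeEquiv {m : ℕ} (g : Fin m → Pairs (l + 1) ⊕ Fin l) :
    edgeMultiset (fun a => (splitEdgeEquiv (g a)).1.1) (fun a => (splitEdgeEquiv (g a)).1.2) =
      ∑ a, Sum.elim (fun p => {(p.1.1.castSucc, p.1.2.castSucc)})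
        (fun t => {(t.castSucc.castSucc, Fin.last (l + 1))}) (g a) := by
  refine Finset.sum_congr rfl fun a _ => ?_
  beta_reduce
  rcases g a with p | t <;> rfl

theorem edgeMultiset_legs {m : ℕ} (e : Fin m → Pairs (l + 1)) (d : Fin l → ℕ) :
    edgeMultiset (legSrc (d▹0) e) (legTgt (d▹0) e) =
      ∑ a, {((e a).1.1.castSucc, (e a).1.2.castSucc)} +
        ∑ t, d t • {(t.castSucc.castSucc, Fin.last (l + 1))} := by
  rw [edgeMultiset, Fintype.sum_sum_type, Fintype.sum_sigma]
  simp [Fin.sum_univ_castSucc, legSrc, legTgt]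

theorem card_legs_last {n m : ℕ} (e : Fin m → Pairs n) (d : Fin n → ℕ) :
    (Finset.univ.filter fun j => Sum.elim (legSrc d e) (legTgt d e) j = Fin.last n).card =
      ∑ t, d t := by
  rw [Finset.card_filter]
  simp only [Fintype.sum_sum_type, Fintype.sum_sigma, Sum.elim_inl, Sum.elim_inr]
  simp [legSrc, legTgt, Fin.castSucc_ne_last]

end Edges

section TimeOrderedProduct

variable {Δ : Bidistribution} {l : ℕ}

theorem coeff_snoc_mem_smoothAlong {n : ℕ} {F : Fin n → PowerSeries Functional}
    {G : PowerSeries Functional} (hF : ∀ i k, PowerSeries.coeff k (F i) ∈ smoothAlong Config ℂ)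
    (hG : ∀ k, PowerSeries.coeff k G ∈ smoothAlong Config ℂ) (q : Fin (n + 1)) (k : ℕ) :
    PowerSeries.coeff k ((F▹G) q) ∈ smoothAlong Config ℂ := by
  cases q using Fin.lastCases with
  | last => simpa only [Fin.snoc_last] using hG k
  | cast i => simpa only [Fin.snoc_castSucc] using hF i k

theorem hasContraction_legs_zero {n m : ℕ} {F : Fin n → PowerSeries Functional}
    {C : PowerSeries Functional} {d : Fin n → ℕ}
    (hC : ∀ k, PowerSeries.coeff k C ∈ smoothAlong Config ℂ)
    (hc : ∀ k φ, IsFunctionalDeriv (PowerSeries.coeff k C) φ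
      (0 : CompactDistribution (Fin (∑ t, d t))))
    (e : Fin m → Pairs n) (k : Fin (n + 1) → ℕ) (φ : Config) :
    HasContraction Δ (fun i => PowerSeries.coeff (k i) ((F▹C) i))
      (legSrc d e) (legTgt d e) φ 0 := by
  refine HasContraction.of_tensorDirDeriv_eq_zero fun h =>
    Finset.prod_eq_zero (Finset.mem_univ (Fin.last n)) ?_
  simp only [Fin.snoc_last]
  refine (dirDeriv_subtype ⟨_, hC (k (Fin.last n))⟩ φ h _).trans
    (iterDir_eq_zero_of_isFunctionalDeriv_zero _ φ h ?_)
  rw [card_legs_last]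
  exact hc _ φ

theorem timeOrderedPaired_eq_zero {n : ℕ} {F : Fin n → PowerSeries Functional}
    {C : PowerSeries Functional} {d : Fin n → ℕ}
    (hC : ∀ k, PowerSeries.coeff k C ∈ smoothAlong Config ℂ)
    (hc : ∀ k φ, IsFunctionalDeriv (PowerSeries.coeff k C) φ
      (0 : CompactDistribution (Fin (∑ t, d t)))) :
    timeOrderedPaired Δ F d C = 0 := by
  ext N φ
  simp only [timeOrderedPaired, coeff_hbarSum, contractionSeries, map_zero,
    LinearMap.map_smul_of_tower, map_sum, PowerSeries.coeff_mk, Finset.sum_apply, Pi.smul_apply,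
    (hasContraction_legs_zero hC hc _ _ φ).contraction_eq, Finset.sum_const_zero, smul_zero,
    Pi.zero_apply]

variable {A : Fin l → PowerSeries Functional} {B C : PowerSeries Functional} {c : ℕ}

theorem contractionDefined_splitEdge
    (hA : ∀ t k, PowerSeries.coeff k (A t) ∈ smoothAlong Config ℂ)
    (hB : ∀ k, PowerSeries.coeff k B ∈ smoothAlong Config ℂ)
    (hC : ∀ k, PowerSeries.coeff k C ∈ smoothAlong Config ℂ)
    (hc : ∀ i > c, ∀ k φ,
      IsFunctionalDeriv (PowerSeries.coeff k C) φ (0 : CompactDistribution (Fin i)))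
    (hdef : ∀ d : Fin l → ℕ, ∑ t, d t ≤ c → TimeOrderedPairedDefined Δ (A▹B) (d▹0) C)
    {m : ℕ} (g : Fin m → SplitEdge l) :
    ContractionDefined Δ (A▹B▹C) (fun a => (g a).1.1) fun a => (g a).1.2 := by
  obtain ⟨g, rfl⟩ := splitEdgeEquiv.surjective.comp_left g
  obtain ⟨_, e, d, hed⟩ := exists_sum_sumElim_eq
    (fun p : Pairs (l + 1) => ({(p.1.1.castSucc, p.1.2.castSucc)} : Multiset _))
    (fun t => {(t.castSucc.castSucc, Fin.last (l + 1))}) g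
  refine contractionDefined_of_edgeMultiset_eq
    (coeff_snoc_mem_smoothAlong (coeff_snoc_mem_smoothAlong hA hB) hC)
    ((edgeMultiset_splitEdgeEquiv g).trans (hed.trans (edgeMultiset_legs e d).symm)) ?_
  rcases le_or_gt (∑ t, d t) c with hd | hd
  · exact hdef d hd _ e
  · have hlegs : ∑ t, (d▹0 : Fin (l + 1) → ℕ) t > c := by
      simpa only [Fin.sum_snoc, add_zero] using hd
    exact fun k φ => ⟨0, hasContraction_legs_zero hC (hc _ hlegs) e k φ⟩

theorem inv_factorial_smul_sum_contractionSeries_snoc_mul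
    (hA : ∀ t k, PowerSeries.coeff k (A t) ∈ smoothAlong Config ℂ)
    (hB : ∀ k, PowerSeries.coeff k B ∈ smoothAlong Config ℂ)
    (hC : ∀ k, PowerSeries.coeff k C ∈ smoothAlong Config ℂ) (m : ℕ)
    (hdef : ∀ g : Fin m → SplitEdge l,
      ContractionDefined Δ (A▹B▹C) (fun a => (g a).1.1) fun a => (g a).1.2) :
    (m.factorial : ℂ)⁻¹ • ∑ e : Fin m → Pairs (l + 1),
        contractionSeries Δ (A▹(B * C)) (fun a => (e a).1.1) (fun a => (e a).1.2) =
      ∑ i ∈ Finset.range (m + 1), ∑ d ∈ Finset.piAntidiag Finset.univ i,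
        (∏ t, ((d t).factorial : ℂ))⁻¹ • ((m - i).factorial : ℂ)⁻¹ •
          ∑ e : Fin (m - i) → Pairs (l + 1),
            contractionSeries Δ (A▹B▹C) (legSrc (d▹0) e) (legTgt (d▹0) e) := by
  have hgraph := fun {κ : Type} [Fintype κ] => contractionSeries_eq_graphContraction (κ := κ)
    (Δ := Δ) (coeff_snoc_mem_smoothAlong (coeff_snoc_mem_smoothAlong hA hB) hC)
  simp only [hgraph (legSrc _ _), edgeMultiset_legs]
  rw [← inv_factorial_smul_sum_words (graphContraction Δ (A▹B▹C))
    (fun p : Pairs (l + 1) => {(p.1.1.castSucc, p.1.2.castSucc)})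
    fun t : Fin l => {(t.castSucc.castSucc, Fin.last (l + 1))}]
  congr 1
  calc ∑ e : Fin m → Pairs (l + 1),
        contractionSeries Δ (A▹(B * C)) (fun a => (e a).1.1) (fun a => (e a).1.2)
      = ∑ g : Fin m → SplitEdge l,
          contractionSeries Δ (A▹B▹C) (fun a => (g a).1.1) fun a => (g a).1.2 := by
        rw [← Finset.sum_fiberwise _ (mergeEdge ∘ ·)]
        exact Finset.sum_congr rfl fun e _ =>
          contractionSeries_snoc_mul hA hB hC fun g _ => hdef g
    _ = _ := (Fintype.sum_equiv (Equiv.arrowCongr (Equiv.refl _) splitEdgeEquiv) _ _ fun g => by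
        rw [hgraph, ← edgeMultiset_splitEdgeEquiv]
        rfl).symm

theorem timeOrdered_snoc_mul
    (hA : ∀ t k, PowerSeries.coeff k (A t) ∈ smoothAlong Config ℂ)
    (hB : ∀ k, PowerSeries.coeff k B ∈ smoothAlong Config ℂ)
    (hC : ∀ k, PowerSeries.coeff k C ∈ smoothAlong Config ℂ)
    (hdef : ∀ (m : ℕ) (g : Fin m → SplitEdge l),
      ContractionDefined Δ (A▹B▹C) (fun a => (g a).1.1) fun a => (g a).1.2) :
    timeOrdered Δ (A▹(B * C)) = hbarSum fun i => ∑ d ∈ Finset.piAntidiag Finset.univ i,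
      (∏ t, ((d t).factorial : ℂ))⁻¹ • timeOrderedPaired Δ (A▹B) (d▹0) C := by
  simp only [timeOrdered, timeOrderedPaired, ← hbarSum_smul, ← hbarSum_sum]
  rw [← hbarSum_sum_range_diag]
  exact congrArg hbarSum (funext fun m =>
    inv_factorial_smul_sum_contractionSeries_snoc_mul hA hB hC m (hdef m))

end TimeOrderedProduct

end PAQFT

open PAQFT in
theorem mainTheorem11_general (Δ : Bidistribution) (l c : ℕ)
    (A : Fin l → PowerSeries Functional) (B C : PowerSeries Functional)
    (hA : ∀ t k, PowerSeries.coeff k (A t) ∈ smoothAlong Config ℂ)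
    (hB : ∀ k, PowerSeries.coeff k B ∈ smoothAlong Config ℂ)
    (hC : ∀ k, PowerSeries.coeff k C ∈ smoothAlong Config ℂ)
    (hc : ∀ i > c, ∀ k φ,
      IsFunctionalDeriv (PowerSeries.coeff k C) φ (0 : CompactDistribution (Fin i)))
    (hdef : ∀ d : Fin l → ℕ, ∑ t, d t ≤ c → TimeOrderedPairedDefined Δ (A▹B) (d▹0) C) :
    TimeOrderedDefined Δ (A▹(B * C)) ∧
      timeOrdered Δ (A▹(B * C)) =
        ∑ i ∈ Finset.range (c + 1), PowerSeries.X ^ i *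
          ∑ d ∈ Finset.piAntidiag Finset.univ i,
            (∏ t, ((d t).factorial : ℂ))⁻¹ • timeOrderedPaired Δ (A▹B) (d▹0) C := by
  have hsplit := fun (m : ℕ) => contractionDefined_splitEdge (m := m) hA hB hC hc hdef
  refine ⟨fun m e k φ => ⟨_, hasContraction_snoc_mul hA hB hC (fun g _ => hsplit m g) k φ⟩, ?_⟩
  rw [timeOrdered_snoc_mul hA hB hC hsplit]
  refine hbarSum_eq_sum_range fun i hi => Finset.sum_eq_zero fun d hd => ?_
  have hlegs : ∑ t, (d▹0 : Fin (l + 1) → ℕ) t = i := by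
    simpa only [Fin.sum_snoc, add_zero] using (Finset.mem_piAntidiag.1 hd).1
  rw [timeOrderedPaired_eq_zero hC (hc _ (hlegs ▸ hi)), smul_zero]

end

theorem mainTheorem11 (Δ : PAQFT.Bidistribution) (l c : ℕ)
    (A : Fin l → PowerSeries PAQFT.Functional) (B C : PowerSeries PAQFT.Functional)
    (hA : ∀ t k, PAQFT.IsSmooth (PowerSeries.coeff k (A t)))
    (hB : ∀ k, PAQFT.IsSmooth (PowerSeries.coeff k B))
    (hC : ∀ k, PAQFT.IsSmooth (PowerSeries.coeff k C))
    (hc : ∀ i > c, ∀ (k : ℕ) (φ : PAQFT.Config),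
      PAQFT.IsFunctionalDeriv (PowerSeries.coeff k C) φ (0 : PAQFT.CompactDistribution (Fin i)))
    (hdef : ∀ d : Fin l → ℕ, ∑ t, d t ≤ c →
      PAQFT.TimeOrderedPairedDefined Δ
        (Fin.snoc (α := fun _ => PowerSeries PAQFT.Functional) A B)
        (Fin.snoc (α := fun _ => ℕ) d 0) C) :
    PAQFT.TimeOrderedDefined Δ
        (Fin.snoc (α := fun _ => PowerSeries PAQFT.Functional) A (B * C)) ∧
      PAQFT.timeOrdered Δ
          (Fin.snoc (α := fun _ => PowerSeries PAQFT.Functional) A (B * C)) =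
        ∑ i ∈ Finset.range (c + 1), PowerSeries.X ^ i *
          ∑ d ∈ Finset.piAntidiag (Finset.univ : Finset (Fin l)) i,
            (∏ t, ((d t).factorial : ℂ))⁻¹ •
              PAQFT.timeOrderedPaired Δ
                (Fin.snoc (α := fun _ => PowerSeries PAQFT.Functional) A B)
                (Fin.snoc (α := fun _ => ℕ) d 0) C :=
  mainTheorem11_general Δ l c A B C (fun t k => (hA t k).1) (fun k => (hB k).1)
    (fun k => (hC k).1) hc hdef
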